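/- Let $0<\delta<1$ and $R_\delta=\{z\in\mathbb{C}:\delta<|z|<1\}$. For a holomorphic function $\varphi:R_\delta\to\mathbb{C}$ put $$\|\varphi\|_{\mathrm{dp}}=\sup\|\varphi(X)\|\in[0,\infty],$$ where the supremum is over all bounded invertible operators $X$ on complex Hilbert spaces with $\|X\|\le 1$, $\|X^{-1}\|\le 1/\delta$ and spectrum $\sigma(X)\subseteq R_\delta$, and $\varphi(X)$ is given by the Riesz--Dunford functional calculus. Let $\lambda_1,\dots,\lambda_n$ be distinct points of $R_\delta$, and let $\mathcal{G}_{\mathrm{dp}}(\lambda)$ be the set of positive definite complex $n\times n$ matrices $g=[g_{ij}]$ (the DP Szegő kernels for $\lambda$) such that both matrices $$\left[(1-\overline{\lambda_i}\lambda_j)\,g_{ij}\right]_{i,j=1}^n\quad\text{and}\quad\left[\left(1-\frac{\delta^2}{\overline{\lambda_i}\lambda_j}\right)g_{ij}\right]_{i,j=1}^n$$ are positive semidefinite. Let $z_1,\dots,z_n\in\mathbb{C}$. Then there exists a holomorphic function $\varphi$ on $R_\delta$ with $\|\varphi\|_{\mathrm{dp}}\le 1$ and $\varphi(\lambda_j)=z_j$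 for $j=1,\dots,n$ if and only if, for every $g\in\mathcal{G}_{\mathrm{dp}}(\lambda)$, the matrix $\left[(1-\overline{z_i}z_j)\,g_{ij}\right]_{i,j=1}^n$ is positive semidefinite. -/

import Mathlib

universe u

open scoped ENNReal ComplexOrder

noncomputable section

/-- The open annulus `R_δ = {z : δ < |z| < 1}`. -/
def annulus (δ : ℝ) : Set ℂ := {z : ℂ | δ < ‖z‖ ∧ ‖z‖ < 1}

/-- `X` is a Douglas-Paulsen operator with parameter `δ`: `X` is invertible, `‖X‖ ≤ 1` and
`‖X⁻¹‖ ≤ 1 / δ`. -/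
structure IsDouglasPaulsen (δ : ℝ) {H : Type u} [NormedAddCommGroup H] [InnerProductSpace ℂ H]
    (X : H →L[ℂ] H) : Prop where
  isUnit : IsUnit X
  norm_le : ‖X‖ ≤ 1
  norm_inverse_le : ‖Ring.inverse X‖ ≤ 1 / δ

/-- The members of the Douglas-Paulsen family with parameter `δ` acting on the Hilbert space `H`:
the Douglas-Paulsen operators with spectrum in the annulus. -/
def dpFamily (δ : ℝ) (H : Type u) [NormedAddCommGroup H] [InnerProductSpace ℂ H] :
    Set (H →L[ℂ] H) :=
  {X | IsDouglasPaulsen δ X ∧ spectrum ℂ X ⊆ annulus δ}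

/-- The circles of radii `r < R` about `0` lie in the annulus and the spectrum of `T` lies strictly
between them, so that the outer circle (anticlockwise) and the inner circle (clockwise)
together form a contour in the annulus which winds once around the spectrum. -/
def IsAnnularContour (δ : ℝ) {H : Type u} [NormedAddCommGroup H] [InnerProductSpace ℂ H]
    (T : H →L[ℂ] H) (r R : ℝ) : Prop :=
  δ < r ∧ r < R ∧ R < 1 ∧ ∀ z ∈ spectrum ℂ T, r < ‖z‖ ∧ ‖z‖ < R

/-- The Riesz-Dunford integral `(2πi)⁻¹ ∫ φ(z) (z - T)⁻¹ dz` over the contour consisting of the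
circle of radius `R` about `0`, anticlockwise, and the circle of radius `r`, clockwise. -/
def rieszDunford (φ : ℂ → ℂ) {H : Type u} [NormedAddCommGroup H] [InnerProductSpace ℂ H]
    (T : H →L[ℂ] H) (r R : ℝ) : H →L[ℂ] H :=
  (2 * Real.pi * Complex.I : ℂ)⁻¹ •
    (circleIntegral (fun z => φ z • resolvent T z) 0 R -
      circleIntegral (fun z => φ z • resolvent T z) 0 r)

/-- An operator with spectrum in the annulus has an annular contour around its spectrum. -/
theorem exists_isAnnularContour {δ : ℝ} (hδ1 : δ < 1) {H : Type u}
    [NormedAddCommGroup H] [InnerProductSpace ℂ H] [CompleteSpace H] (T : H →L[ℂ] H)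
    (hT : spectrum ℂ T ⊆ annulus δ) : ∃ p : ℝ × ℝ, IsAnnularContour δ T p.1 p.2 := by
  rcases (spectrum ℂ T).eq_empty_or_nonempty with h | h
  · refine ⟨((2 * δ + 1) / 3, (δ + 2) / 3), ?_, ?_, ?_, ?_⟩
    · dsimp only; linarith
    · dsimp only; linarith
    · dsimp only; linarith
    · simp [h]
  · obtain ⟨a, ha, hmin⟩ := (spectrum.isCompact (𝕜 := ℂ) T).exists_isMinOn h
      continuous_norm.continuousOn
    obtain ⟨b, hb, hmax⟩ := (spectrum.isCompact (𝕜 := ℂ) T).exists_isMaxOn h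
      continuous_norm.continuousOn
    have h1 := (hT ha).1
    have h2 := (hT hb).2
    have h3 : ‖a‖ ≤ ‖b‖ := hmin hb
    refine ⟨((δ + ‖a‖) / 2, (‖b‖ + 1) / 2), ?_, ?_, ?_, fun z hz => ?_⟩
    · dsimp only; linarith
    · dsimp only; linarith
    · dsimp only; linarith
    · have h4 : ‖a‖ ≤ ‖z‖ := hmin hz
      have h5 : ‖z‖ ≤ ‖b‖ := hmax hz
      constructor
      · dsimp only; linarith
      · dsimp only; linarith

/-- Two concentric circles in the annulus with no spectrum on or between them give the same
integral. -/
theorem circleIntegral_resolvent_eq {δ : ℝ} (hδ0 : 0 < δ) {φ : ℂ → ℂ}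
    (hφ : DifferentiableOn ℂ φ (annulus δ)) {H : Type u}
    [NormedAddCommGroup H] [InnerProductSpace ℂ H] [CompleteSpace H] (T : H →L[ℂ] H)
    {s t : ℝ} (hs : δ < s) (hst : s ≤ t) (ht : t < 1)
    (hT : ∀ z ∈ spectrum ℂ T, ‖z‖ < s ∨ t < ‖z‖) :
    circleIntegral (fun z => φ z • resolvent T z) 0 t =
      circleIntegral (fun z => φ z • resolvent T z) 0 s := by
  have hd : ∀ z : ℂ, s ≤ ‖z‖ → ‖z‖ ≤ t →
      DifferentiableAt ℂ (fun z => φ z • resolvent T z) z := by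
    intro z h1 h2
    have hopen : IsOpen (annulus δ) :=
      (isOpen_lt continuous_const continuous_norm).inter
        (isOpen_lt continuous_norm continuous_const)
    have hz : z ∈ annulus δ := ⟨by linarith, by linarith⟩
    have hr : z ∈ resolventSet ℂ T := by
      by_contra hc
      rcases hT z hc with h | h <;> linarith
    exact (hφ.differentiableAt (hopen.mem_nhds hz)).smul
      (spectrum.hasDerivAt_resolvent_const_left hr).differentiableAt
  refine Complex.circleIntegral_eq_of_differentiable_on_annulus_off_countable (by linarith) hst
    (Set.countable_empty) ?_ ?_
  · intro z hz
    simp only [Set.mem_sdiff, Metric.mem_closedBall, dist_zero_right, Metric.mem_ball,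
      not_lt] at hz
    exact (hd z hz.2 hz.1).continuousAt.continuousWithinAt
  · intro z hz
    simp only [Set.mem_sdiff, Metric.mem_closedBall, dist_zero_right, Metric.mem_ball,
      not_le, Set.mem_empty_iff_false, not_false_eq_true, and_true] at hz
    exact hd z hz.2.le hz.1.le

/-- The Riesz-Dunford integral does not depend on the annular contour. -/
theorem rieszDunford_eq {δ : ℝ} (hδ0 : 0 < δ) {φ : ℂ → ℂ}
    (hφ : DifferentiableOn ℂ φ (annulus δ)) {H : Type u}
    [NormedAddCommGroup H] [InnerProductSpace ℂ H] [CompleteSpace H] (T : H →L[ℂ] H)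
    {r R r' R' : ℝ} (h : IsAnnularContour δ T r R) (h' : IsAnnularContour δ T r' R') :
    rieszDunford φ T r R = rieszDunford φ T r' R' := by
  obtain ⟨h1, h2, h3, h4⟩ := h
  obtain ⟨k1, k2, k3, k4⟩ := h'
  have hR : circleIntegral (fun z => φ z • resolvent T z) 0 R =
      circleIntegral (fun z => φ z • resolvent T z) 0 R' := by
    rcases le_total R R' with hle | hle
    · exact (circleIntegral_resolvent_eq hδ0 hφ T (by linarith) hle k3
        fun z hz => Or.inl (h4 z hz).2).symm
    · exact circleIntegral_resolvent_eq hδ0 hφ T (by linarith) hle h3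
        fun z hz => Or.inl (k4 z hz).2
  have hr : circleIntegral (fun z => φ z • resolvent T z) 0 r =
      circleIntegral (fun z => φ z • resolvent T z) 0 r' := by
    rcases le_total r r' with hle | hle
    · exact (circleIntegral_resolvent_eq hδ0 hφ T h1 hle (by linarith)
        fun z hz => Or.inr (k4 z hz).1).symm
    · exact circleIntegral_resolvent_eq hδ0 hφ T k1 hle (by linarith)
        fun z hz => Or.inr (h4 z hz).1
  rw [rieszDunford, rieszDunford, hR, hr]

open Classical in
/-- The operator `φ(T)` of the Riesz-Dunford functional calculus, for `φ` holomorphic on the annulus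
and `T` with spectrum in the annulus: the Riesz-Dunford integral over any annular contour
(one exists by `exists_isAnnularContour`, and the choice is irrelevant by `rieszDunford_eq`). -/
def annulusCalculus (δ : ℝ) (φ : ℂ → ℂ) {H : Type u} [NormedAddCommGroup H]
    [InnerProductSpace ℂ H] (T : H →L[ℂ] H) : H →L[ℂ] H :=
  if h : ∃ p : ℝ × ℝ, IsAnnularContour δ T p.1 p.2 then
    rieszDunford φ T h.choose.1 h.choose.2
  else 0

/-- The Douglas-Paulsen norm `sup ‖φ(X)‖`, possibly infinite, over all complex Hilbert spaces and
all members `X` of the Douglas-Paulsen family on them. -/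
def dpNorm (δ : ℝ) (φ : ℂ → ℂ) : ℝ≥0∞ :=
  ⨆ (H : Type u) (_ : NormedAddCommGroup H) (_ : InnerProductSpace ℂ H) (_ : CompleteSpace H)
    (X : H →L[ℂ] H) (_ : X ∈ dpFamily δ H), ‖annulusCalculus δ φ X‖ₑ

/-- The dp-Schur class: holomorphic functions on the annulus of dp-norm at most `1`. Only the values
on the annulus of a function `ℂ → ℂ` matter. -/
def dpSchur (δ : ℝ) : Set (ℂ → ℂ) :=
  {φ | DifferentiableOn ℂ φ (annulus δ) ∧ dpNorm.{u} δ φ ≤ 1}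

open scoped ComplexConjugate in
/-- The DP Szegő kernels for the tuple `lam`. -/
def dpSzegoKernels (δ : ℝ) {n : ℕ} (lam : Fin n → ℂ) : Set (Matrix (Fin n) (Fin n) ℂ) :=
  {g | g.PosDef ∧
    (Matrix.of fun i j => (1 - conj (lam i) * lam j) * g i j).PosSemidef ∧
    (Matrix.of fun i j => (1 - (δ / conj (lam i)) * (δ / lam j)) * g i j).PosSemidef}

end

/-! Necessity. Factor a kernel as `g = Wᴴ * W` and let `X` be the operator whose eigenvectors are
the columns of `W`, with eigenvalues `lam j`. The two positivity conditions on `g` say exactly that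
`‖X‖ ≤ 1` and `‖δ X⁻¹‖ ≤ 1`, so `X` is in the Douglas-Paulsen family. `φ(X)` has the same
eigenvectors with eigenvalues `φ (lam j)`, and its contractivity is the positivity of the Pick
matrix against `g` (`posSemidef_of_mem_dpSchur`).

Sufficiency. The sums of `(1 - conj λᵢ λⱼ) Γᵢⱼ` and `(1 - δ² / (conj λᵢ λⱼ)) Δᵢⱼ` with `Γ, Δ ≥ 0`
form a closed convex cone. A functional separating `1 - conj zᵢ zⱼ` from it would yield, after a
small perturbation, a kernel violating the hypothesis; hence `1 - conj zᵢ zⱼ` lies in the cone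
(`mem_weightedPosSemidefCone`). Moving the negative terms across turns this decomposition into an
equality of two Gram matrices, hence into an isometric matrix `v` (the lurking isometry). Closing
the loop through `E(z) = diag(z, …, δ/z, …)` gives the transfer function `φ = v₀₀ + v₀₁ E (1 - v₁₁
E)⁻¹ v₁₀`, which interpolates. The functional calculus replaces `E` by the contractions `X` and `δ
X⁻¹`, and isometry of `v` then forces `‖φ(X)‖ ≤ 1` (`transferFunction_mem_dpSchur`). -/

theorem isOpen_annulus (δ : ℝ) : IsOpen (annulus δ) :=
  (isOpen_lt continuous_const continuous_norm).inter (isOpen_lt continuous_norm continuous_const)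

theorem ContinuousLinearMap.circleIntegral_comp_comm {E F : Type*} [NormedAddCommGroup E]
    [NormedSpace ℂ E] [CompleteSpace E] [NormedAddCommGroup F] [NormedSpace ℂ F] [CompleteSpace F]
    (L : E →L[ℂ] F) {f : ℂ → E} {c : ℂ} {R : ℝ} (hf : CircleIntegrable f c R) :
    circleIntegral (fun z => L (f z)) c R = L (circleIntegral f c R) := by
  rw [circleIntegral, circleIntegral, ← L.intervalIntegral_comp_comm hf.out]
  simp

/-! ### Riesz-Dunford calculus on the annulus -/

section Calculus

variable {δ : ℝ} {H : Type u} [NormedAddCommGroup H] [InnerProductSpace ℂ H]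
  {T : H →L[ℂ] H} {r R : ℝ}

theorem IsAnnularContour.mem_resolventSet (h : IsAnnularContour δ T r R) {z : ℂ}
    (hz : ‖z‖ = r ∨ ‖z‖ = R) : z ∈ resolventSet ℂ T := by
  by_contra hc
  have := h.2.2.2 z hc
  rcases hz with hz | hz <;> linarith [this.1, this.2]

theorem IsAnnularContour.mem_annulus (h : IsAnnularContour δ T r R) {z : ℂ}
    (hz : ‖z‖ = r ∨ ‖z‖ = R) : z ∈ annulus δ := by
  obtain ⟨h1, h2, h3, -⟩ := h
  rcases hz with hz | hz
  · exact ⟨by linarith, by linarith⟩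
  · exact ⟨by linarith, by linarith⟩

theorem resolvent_apply_of_eigenvector {a z : ℂ} {v : H} (hv : T v = a • v)
    (hz : z ∈ resolventSet ℂ T) (hza : z - a ≠ 0) : resolvent T z v = (z - a)⁻¹ • v := by
  have h1 : (resolvent T z * (algebraMap ℂ (H →L[ℂ] H) z - T)) = 1 :=
    Ring.inverse_mul_cancel _ hz
  have h2 := congrArg (fun S : H →L[ℂ] H => S v) h1
  simp only [mul_apply_eq_comp, sub_apply,
    one_apply_eq_self, Algebra.algebraMap_eq_smul_one, smul_apply,
    hv, ← sub_smul, map_smul] at h2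
  rw [eq_inv_smul_iff₀ hza, h2]

theorem circleIntegral_congr_of_isAnnularContour {E : Type*} [NormedAddCommGroup E]
    [NormedSpace ℂ E] (hδ0 : 0 < δ) (h : IsAnnularContour δ T r R) {f g : ℂ → E}
    (hfg : ∀ z, z ∈ annulus δ → z ∈ resolventSet ℂ T → f z = g z) {s : ℝ} (hs : s = r ∨ s = R) :
    circleIntegral f 0 s = circleIntegral g 0 s := by
  have hs0 : 0 ≤ s := by
    rcases hs with rfl | rfl
    · linarith [h.1]
    · linarith [h.1, h.2.1]
  refine circleIntegral.integral_congr hs0 fun z hz => ?_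
  have hz' : ‖z‖ = r ∨ ‖z‖ = R := by
    rw [mem_sphere_zero_iff_norm] at hz
    rw [hz]
    exact hs
  exact hfg z (h.mem_annulus hz') (h.mem_resolventSet hz')

variable [CompleteSpace H]

theorem annulusCalculus_eq_rieszDunford (hδ0 : 0 < δ) {φ : ℂ → ℂ}
    (hφ : DifferentiableOn ℂ φ (annulus δ)) (h : IsAnnularContour δ T r R) :
    annulusCalculus δ φ T = rieszDunford φ T r R := by
  have hex : ∃ p : ℝ × ℝ, IsAnnularContour δ T p.1 p.2 := ⟨(r, R), h⟩
  rw [annulusCalculus, dif_pos hex]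
  exact rieszDunford_eq hδ0 hφ T hex.choose_spec h

theorem IsAnnularContour.circleIntegrable (hδ0 : 0 < δ) (h : IsAnnularContour δ T r R) {φ : ℂ → ℂ}
    (hφ : DifferentiableOn ℂ φ (annulus δ)) {s : ℝ} (hs : s = r ∨ s = R) :
    CircleIntegrable (fun z => φ z • resolvent T z) 0 s := by
  have hs0 : 0 ≤ s := by
    rcases hs with rfl | rfl
    · linarith [h.1]
    · linarith [h.1, h.2.1]
  refine ContinuousOn.circleIntegrable hs0 fun z hz => ContinuousAt.continuousWithinAt ?_
  have hz' : ‖z‖ = r ∨ ‖z‖ = R := by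
    rw [mem_sphere_zero_iff_norm] at hz
    rw [hz]
    exact hs
  exact ((hφ.differentiableAt ((isOpen_annulus δ).mem_nhds (h.mem_annulus hz'))).smul
    (spectrum.hasDerivAt_resolvent_const_left (h.mem_resolventSet hz')).differentiableAt).continuousAt

/-- Cauchy's theorem on the annulus. -/
theorem circleIntegral_eq_of_differentiableOn_annulus {E : Type*} [NormedAddCommGroup E]
    [NormedSpace ℂ E] [CompleteSpace E] (hδ0 : 0 < δ) (hr : δ < r) (hrR : r ≤ R) (hR : R < 1)
    {f : ℂ → E} (hf : DifferentiableOn ℂ f (annulus δ)) :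
    circleIntegral f 0 R = circleIntegral f 0 r := by
  have hd : ∀ z : ℂ, r ≤ ‖z‖ → ‖z‖ ≤ R → DifferentiableAt ℂ f z := fun z h1 h2 =>
    hf.differentiableAt ((isOpen_annulus δ).mem_nhds ⟨by linarith, by linarith⟩)
  refine Complex.circleIntegral_eq_of_differentiable_on_annulus_off_countable (by linarith) hrR
    Set.countable_empty ?_ ?_
  · intro z hz
    simp only [Set.mem_sdiff, Metric.mem_closedBall, dist_zero_right, Metric.mem_ball,
      not_lt] at hz
    exact (hd z hz.2 hz.1).continuousAt.continuousWithinAt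
  · intro z hz
    simp only [Set.mem_sdiff, Metric.mem_closedBall, dist_zero_right, Metric.mem_ball,
      not_le, Set.mem_empty_iff_false, not_false_eq_true, and_true] at hz
    exact hd z hz.2.le hz.1.le

/-- Cauchy's integral formula on the annulus. -/
theorem circleIntegral_sub_circleIntegral_div (hδ0 : 0 < δ) (hr : δ < r) (hR : R < 1) {a : ℂ}
    (ha : r < ‖a‖ ∧ ‖a‖ < R) {φ : ℂ → ℂ} (hφ : DifferentiableOn ℂ φ (annulus δ)) :
    circleIntegral (fun z => φ z * (z - a)⁻¹) 0 R - circleIntegral (fun z => φ z * (z - a)⁻¹) 0 r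
      = 2 * Real.pi * Complex.I * φ a := by
  have haA : annulus δ ∈ nhds a :=
    (isOpen_annulus δ).mem_nhds ⟨by linarith [ha.1], by linarith [ha.2]⟩
  -- Split `φ z / (z - a)` into the difference quotient, holomorphic across `a` and so with equal
  -- integrals over both circles, and `φ a / (z - a)`, which integrates to `2πi φ a` on the outer
  -- circle and `0` on the inner one.
  have hd : DifferentiableOn ℂ (dslope φ a) (annulus δ) :=
    (Complex.differentiableOn_dslope haA).2 hφ
  have heq := circleIntegral_eq_of_differentiableOn_annulus hδ0 hr (ha.1.trans ha.2).le hR hd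
  have hs : ∀ s : ℝ, δ < s → s < 1 → s ≠ ‖a‖ →
      circleIntegral (fun z => φ z * (z - a)⁻¹) 0 s =
        circleIntegral (dslope φ a) 0 s + φ a * circleIntegral (fun z => (z - a)⁻¹) 0 s := by
    intro s h1 h2 h3
    have hne : ∀ z ∈ Metric.sphere (0 : ℂ) s, z - a ≠ 0 := by
      intro z hz h0
      rw [sub_eq_zero] at h0
      rw [mem_sphere_zero_iff_norm, h0] at hz
      exact h3 hz.symm
    have hsub : Metric.sphere (0 : ℂ) s ⊆ annulus δ := by
      intro z hz
      rw [mem_sphere_zero_iff_norm] at hz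
      exact ⟨by linarith, by linarith⟩
    rw [← circleIntegral.integral_const_mul, ← circleIntegral.integral_add]
    · refine circleIntegral.integral_congr (by linarith) fun z hz => ?_
      have := hne z hz
      rw [dslope_of_ne _ (sub_ne_zero.1 this), slope_def_field]
      field_simp
      ring
    · exact (hd.continuousOn.mono hsub).circleIntegrable (by linarith)
    · exact ContinuousOn.circleIntegrable (by linarith)
        (continuousOn_const.mul ((continuousOn_id.sub continuousOn_const).inv₀ hne))
  have hR1 : circleIntegral (fun z => (z - a)⁻¹) 0 R = 2 * Real.pi * Complex.I :=
    circleIntegral.integral_sub_inv_of_mem_ball (by simpa using ha.2)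
  have hr1 : circleIntegral (fun z => (z - a)⁻¹) 0 r = 0 := by
    refine Complex.circleIntegral_eq_zero_of_differentiable_on_off_countable (by linarith)
      Set.countable_empty ?_ ?_
    · refine (continuousOn_id.sub continuousOn_const).inv₀ fun z hz h0 => ?_
      have hz' : ‖z‖ ≤ r := by simpa using hz
      replace h0 : z = a := sub_eq_zero.1 h0
      rw [h0] at hz'
      linarith [ha.1]
    · intro z hz
      have hz' : ‖z‖ < r := by simpa using hz.1
      refine (differentiableAt_id.sub_const a).inv fun h0 => ?_
      replace h0 : z = a := sub_eq_zero.1 h0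
      rw [h0] at hz'
      linarith [ha.1]
  rw [hs R (by linarith [ha.1, ha.2]) hR ha.2.ne', hs r hr (by linarith [ha.1, ha.2]) ha.1.ne, heq,
    hR1, hr1]
  ring

/-- On an eigenvector the resolvent is the scalar `(z - a)⁻¹`, so the operator integral collapses to
Cauchy's formula. -/
theorem annulusCalculus_apply_of_eigenvector (hδ0 : 0 < δ) (hδ1 : δ < 1)
    (hT : spectrum ℂ T ⊆ annulus δ) {φ : ℂ → ℂ} (hφ : DifferentiableOn ℂ φ (annulus δ))
    {a : ℂ} {v : H} (hv : T v = a • v) : annulusCalculus δ φ T v = φ a • v := by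
  rcases eq_or_ne v 0 with rfl | hv0
  · simp
  obtain ⟨⟨r, R⟩, h⟩ := exists_isAnnularContour hδ1 T hT
  dsimp only at h
  have hspec : ∀ z ∈ resolventSet ℂ T, z - a ≠ 0 := by
    intro z hz h0
    have hz' : IsUnit (algebraMap ℂ (H →L[ℂ] H) z - T) := hz
    have h1 : Ring.inverse (algebraMap ℂ (H →L[ℂ] H) z - T) * (algebraMap ℂ (H →L[ℂ] H) z - T) = 1 :=
      Ring.inverse_mul_cancel _ hz'
    have h2 := congrArg (fun S : H →L[ℂ] H => S v) h1
    simp only [mul_apply_eq_comp, sub_apply,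
      one_apply_eq_self, Algebra.algebraMap_eq_smul_one,
      smul_apply, hv, ← sub_smul, h0, zero_smul, map_zero] at h2
    exact hv0 h2.symm
  have ha : r < ‖a‖ ∧ ‖a‖ < R := h.2.2.2 a fun hmem => hspec a hmem (sub_self a)
  rw [annulusCalculus_eq_rieszDunford hδ0 hφ h, rieszDunford]
  have key : ∀ s, s = r ∨ s = R → circleIntegral (fun z => φ z • resolvent T z) 0 s v =
      circleIntegral (fun z => φ z * (z - a)⁻¹) 0 s • v := by
    intro s hs
    have := (ContinuousLinearMap.apply ℂ H v).circleIntegral_comp_comm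
      (h.circleIntegrable hδ0 hφ hs)
    rw [ContinuousLinearMap.apply_apply] at this
    rw [← this, ← circleIntegral.integral_smul_const]
    refine circleIntegral_congr_of_isAnnularContour hδ0 h (fun z _ hz => ?_) hs
    simp only [ContinuousLinearMap.apply_apply, smul_apply]
    rw [resolvent_apply_of_eigenvector hv hz (hspec z hz), smul_smul]
  rw [smul_apply, sub_apply, key R (Or.inr rfl),
    key r (Or.inl rfl), ← sub_smul, circleIntegral_sub_circleIntegral_div hδ0 h.1 h.2.2.1 ha hφ,
    smul_smul, inv_mul_cancel_left₀ Complex.two_pi_I_ne_zero]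

theorem rieszDunford_add (hδ0 : 0 < δ) (h : IsAnnularContour δ T r R) {φ ψ : ℂ → ℂ}
    (hφ : DifferentiableOn ℂ φ (annulus δ)) (hψ : DifferentiableOn ℂ ψ (annulus δ)) :
    rieszDunford (fun z => φ z + ψ z) T r R = rieszDunford φ T r R + rieszDunford ψ T r R := by
  have key : ∀ s, s = r ∨ s = R → circleIntegral (fun z => (φ z + ψ z) • resolvent T z) 0 s =
      circleIntegral (fun z => φ z • resolvent T z) 0 s +
        circleIntegral (fun z => ψ z • resolvent T z) 0 s := by
    intro s hs
    simp only [add_smul]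
    exact circleIntegral.integral_add (h.circleIntegrable hδ0 hφ hs) (h.circleIntegrable hδ0 hψ hs)
  rw [rieszDunford, rieszDunford, rieszDunford, key R (Or.inr rfl), key r (Or.inl rfl), ← smul_add]
  congr 1
  abel

theorem rieszDunford_const_mul (c : ℂ) (φ : ℂ → ℂ) :
    rieszDunford (fun z => c * φ z) T r R = c • rieszDunford φ T r R := by
  simp only [rieszDunford, mul_smul, circleIntegral.integral_smul, ← smul_sub]
  rw [smul_comm]

theorem rieszDunford_sum (hδ0 : 0 < δ) (h : IsAnnularContour δ T r R) {ι : Type*} (s : Finset ι)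
    {φ : ι → ℂ → ℂ} (hφ : ∀ i, DifferentiableOn ℂ (φ i) (annulus δ)) :
    rieszDunford (fun z => ∑ i ∈ s, φ i z) T r R = ∑ i ∈ s, rieszDunford (φ i) T r R := by
  classical
  induction s using Finset.induction_on with
  | empty => simp [rieszDunford, circleIntegral]
  | insert a s ha ih =>
    simp only [Finset.sum_insert ha]
    rw [rieszDunford_add hδ0 h (hφ a) (DifferentiableOn.fun_sum fun i _ => hφ i), ih]

theorem rieszDunford_congr (hδ0 : 0 < δ) (h : IsAnnularContour δ T r R) {φ ψ : ℂ → ℂ}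
    (hφψ : Set.EqOn φ ψ (annulus δ)) : rieszDunford φ T r R = rieszDunford ψ T r R := by
  have key : ∀ s, s = r ∨ s = R → circleIntegral (fun z => φ z • resolvent T z) 0 s =
      circleIntegral (fun z => ψ z • resolvent T z) 0 s := fun s hs =>
    circleIntegral_congr_of_isAnnularContour hδ0 h (fun z hz _ => by rw [hφψ hz]) hs
  rw [rieszDunford, rieszDunford, key R (Or.inr rfl), key r (Or.inl rfl)]

/-- The Riesz-Dunford calculus turns multiplication by the coordinate into multiplication by the
operator. -/
theorem rieszDunford_id_mul (hδ0 : 0 < δ) (h : IsAnnularContour δ T r R) {φ : ℂ → ℂ}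
    (hφ : DifferentiableOn ℂ φ (annulus δ)) :
    rieszDunford (fun z => z * φ z) T r R = T * rieszDunford φ T r R := by
  -- From `z (z - T)⁻¹ = 1 + T (z - T)⁻¹`; the contribution of `1` cancels between the two circles
  -- by Cauchy's theorem.
  have key : ∀ s, s = r ∨ s = R → circleIntegral (fun z => (z * φ z) • resolvent T z) 0 s =
      circleIntegral (fun z => φ z • (1 : H →L[ℂ] H)) 0 s +
        T * circleIntegral (fun z => φ z • resolvent T z) 0 s := by
    intro s hs
    have h1 := (ContinuousLinearMap.mul ℂ (H →L[ℂ] H) T).circleIntegral_comp_comm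
      (h.circleIntegrable hδ0 hφ hs)
    rw [ContinuousLinearMap.mul_apply'] at h1
    have hs1 : δ < s ∧ s < 1 := by
      obtain ⟨h1, h2, h3, -⟩ := h
      rcases hs with rfl | rfl <;> constructor <;> linarith
    have hsub : Metric.sphere (0 : ℂ) s ⊆ annulus δ := by
      intro z hz
      rw [mem_sphere_zero_iff_norm] at hz
      exact ⟨by linarith [hs1.1], by linarith [hs1.2]⟩
    have h2 : CircleIntegrable (fun z => z * φ z) 0 s :=
      (continuousOn_id.mul (hφ.continuousOn.mono hsub)).circleIntegrable (by linarith [hs1.1])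
    rw [← h1, ← circleIntegral.integral_add]
    · refine circleIntegral_congr_of_isAnnularContour hδ0 h (fun z _ hz => ?_) hs
      have h3 : (algebraMap ℂ (H →L[ℂ] H) z - T) * resolvent T z = 1 :=
        Ring.mul_inverse_cancel _ hz
      rw [sub_mul, Algebra.algebraMap_eq_smul_one, smul_mul_assoc, one_mul, sub_eq_iff_eq_add] at h3
      rw [ContinuousLinearMap.mul_apply', mul_comm z, mul_smul, h3, smul_add, mul_smul_comm]
    · exact ((hφ.continuousOn.mono hsub).smul continuousOn_const).circleIntegrable
        (by linarith [hs1.1])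
    · refine ContinuousOn.circleIntegrable (by linarith [hs1.1]) fun z hz =>
        ContinuousAt.continuousWithinAt ?_
      have hz' : ‖z‖ = r ∨ ‖z‖ = R := by
        rw [mem_sphere_zero_iff_norm] at hz
        rw [hz]
        exact hs
      exact (ContinuousLinearMap.mul ℂ (H →L[ℂ] H) T).continuous.continuousAt.comp
        ((hφ.differentiableAt ((isOpen_annulus δ).mem_nhds (h.mem_annulus hz'))).smul
        (spectrum.hasDerivAt_resolvent_const_left
          (h.mem_resolventSet hz')).differentiableAt).continuousAt
  have heq : circleIntegral (fun z => φ z • (1 : H →L[ℂ] H)) 0 R =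
      circleIntegral (fun z => φ z • (1 : H →L[ℂ] H)) 0 r :=
    circleIntegral_eq_of_differentiableOn_annulus hδ0 h.1 h.2.1.le h.2.2.1
      (hφ.smul (differentiableOn_const _))
  rw [rieszDunford, rieszDunford, key R (Or.inr rfl), key r (Or.inl rfl), heq,
    add_sub_add_left_eq_sub, ← mul_sub, mul_smul_comm]

theorem rieszDunford_inv_mul (hδ0 : 0 < δ) (h : IsAnnularContour δ T r R) (hT : IsUnit T)
    {φ : ℂ → ℂ} (hφ : DifferentiableOn ℂ φ (annulus δ)) :
    rieszDunford (fun z => z⁻¹ * φ z) T r R = Ring.inverse T * rieszDunford φ T r R := by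
  have hne : ∀ z ∈ annulus δ, z ≠ 0 := by
    rintro z hz rfl
    have := hz.1
    rw [norm_zero] at this
    linarith
  have h1 := rieszDunford_id_mul hδ0 h (φ := fun z => z⁻¹ * φ z)
    ((differentiableOn_id.inv hne).mul hφ)
  rw [rieszDunford_congr hδ0 h (ψ := φ) fun z hz => by
    simp only [mul_inv_cancel_left₀ (hne z hz)]] at h1
  rw [h1, ← mul_assoc, Ring.inverse_mul_cancel _ hT, one_mul]

open Filter in
-- The circle can be enlarged freely, and `(z - T)⁻¹ = z⁻¹ + z⁻¹ T (z - T)⁻¹`, where the last term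
-- is `o(1/|z|)` and so contributes nothing in the limit.
theorem circleIntegral_resolvent_of_spectrum_subset_ball (hR : 0 < R)
    (hT : ∀ z ∈ spectrum ℂ T, ‖z‖ < R) :
    circleIntegral (resolvent T) 0 R = (2 * Real.pi * Complex.I) • (1 : H →L[ℂ] H) := by
  have hd : ∀ z : ℂ, R ≤ ‖z‖ → DifferentiableAt ℂ (resolvent T) z := fun z hz =>
    (spectrum.hasDerivAt_resolvent_const_left
      (not_not.1 fun hc => (hT z hc).not_ge hz)).differentiableAt
  have heq : ∀ s, R ≤ s → circleIntegral (resolvent T) 0 s = circleIntegral (resolvent T) 0 R := by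
    intro s hs
    refine Complex.circleIntegral_eq_of_differentiable_on_annulus_off_countable hR hs
      Set.countable_empty ?_ ?_
    · intro z hz
      simp only [Set.mem_sdiff, Metric.mem_closedBall, dist_zero_right, Metric.mem_ball,
        not_lt] at hz
      exact (hd z hz.2).continuousAt.continuousWithinAt
    · intro z hz
      simp only [Set.mem_sdiff, Metric.mem_closedBall, dist_zero_right, Metric.mem_ball,
        not_le, Set.mem_empty_iff_false, not_false_eq_true, and_true] at hz
      exact hd z hz.2.le
  have hlim : Tendsto (fun z : ℂ => T * resolvent T z) (Bornology.cobounded ℂ) (nhds 0) := by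
    have := (spectrum.resolvent_tendsto_cobounded (𝕜 := ℂ) T).const_mul T
    rwa [mul_zero] at this
  rw [← sub_eq_zero, ← norm_le_zero_iff]
  refine le_of_forall_pos_le_add fun ε hε => ?_
  rw [zero_add]
  have hev : ∀ᶠ z in Bornology.cobounded ℂ, ‖T * resolvent T z‖ < ε / (2 * Real.pi) := by
    have := hlim.norm
    rw [norm_zero] at this
    exact this.eventually_lt_const (by positivity)
  obtain ⟨M, -, hM⟩ := (Filter.hasBasis_cobounded_norm (E := ℂ)).eventually_iff.1 hev
  set s := max R M with hs
  have hs0 : 0 < s := lt_max_of_lt_left hR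
  have hcont : ContinuousOn (fun z => resolvent T z) (Metric.sphere (0 : ℂ) s) := by
    intro z hz
    rw [mem_sphere_zero_iff_norm] at hz
    exact (hd z (hz ▸ le_max_left _ _)).continuousAt.continuousWithinAt
  have hinv : ContinuousOn (fun z : ℂ => z⁻¹ • (1 : H →L[ℂ] H)) (Metric.sphere (0 : ℂ) s) := by
    refine (continuousOn_id.inv₀ fun z hz h0 => ?_).smul continuousOn_const
    rw [mem_sphere_zero_iff_norm, show z = 0 from h0, norm_zero] at hz
    exact hs0.ne hz
  have hone : circleIntegral (fun z : ℂ => z⁻¹ • (1 : H →L[ℂ] H)) 0 s =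
      (2 * Real.pi * Complex.I) • (1 : H →L[ℂ] H) := by
    rw [circleIntegral.integral_smul_const]
    have := circleIntegral.integral_sub_center_inv 0 hs0.ne'
    simp only [sub_zero] at this
    rw [this]
  rw [← heq s (le_max_left _ _), ← hone, ← circleIntegral.integral_sub
    (hcont.circleIntegrable hs0.le) (hinv.circleIntegrable hs0.le)]
  have hbound : ∀ z ∈ Metric.sphere (0 : ℂ) s,
      ‖resolvent T z - z⁻¹ • (1 : H →L[ℂ] H)‖ ≤ s⁻¹ * (ε / (2 * Real.pi)) := by
    intro z hz
    rw [mem_sphere_zero_iff_norm] at hz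
    have hz0 : z ≠ 0 := by
      rintro rfl
      rw [norm_zero] at hz
      exact hs0.ne hz
    have h3 : (algebraMap ℂ (H →L[ℂ] H) z - T) * resolvent T z = 1 :=
      Ring.mul_inverse_cancel _
        (not_not.1 fun hc => (hT z hc).not_ge (hz ▸ le_max_left _ _))
    rw [sub_mul, Algebra.algebraMap_eq_smul_one, smul_mul_assoc, one_mul, sub_eq_iff_eq_add] at h3
    have h4 : resolvent T z - z⁻¹ • (1 : H →L[ℂ] H) = z⁻¹ • (T * resolvent T z) := by
      rw [sub_eq_iff_eq_add, ← smul_add, add_comm, ← h3, inv_smul_smul₀ hz0]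
    rw [h4, norm_smul, norm_inv, hz]
    gcongr
    exact (hM (show M ≤ ‖z‖ from hz ▸ le_max_right R M)).le
  calc _ ≤ 2 * Real.pi * s * (s⁻¹ * (ε / (2 * Real.pi))) :=
        circleIntegral.norm_integral_le_of_norm_le_const hs0.le hbound
    _ = ε := by field_simp

/-- The Riesz-Dunford integral of the constant `1` is the identity. -/
theorem rieszDunford_one (hδ0 : 0 < δ) (h : IsAnnularContour δ T r R) :
    rieszDunford (fun _ => 1) T r R = 1 := by
  have hr1 : circleIntegral (resolvent T) 0 r = 0 := by
    have hd : ∀ z : ℂ, ‖z‖ ≤ r → DifferentiableAt ℂ (resolvent T) z := fun z hz =>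
      (spectrum.hasDerivAt_resolvent_const_left
        (not_not.1 fun hc => (h.2.2.2 z hc).1.not_ge hz)).differentiableAt
    refine Complex.circleIntegral_eq_zero_of_differentiable_on_off_countable (by linarith [h.1])
      Set.countable_empty (fun z hz => ?_) fun z hz => hd z ?_
    · exact (hd z (by simpa using hz)).continuousAt.continuousWithinAt
    · have : ‖z‖ < r := by simpa using hz.1
      exact this.le
  simp only [rieszDunford, one_smul]
  rw [hr1, sub_zero, circleIntegral_resolvent_of_spectrum_subset_ball
    (by linarith [h.1, h.2.1]) (fun z hz => (h.2.2.2 z hz).2), smul_smul,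
    inv_mul_cancel₀ Complex.two_pi_I_ne_zero, one_smul]

end Calculus

/-! ### Necessity: kernels as diagonalizable Douglas-Paulsen operators -/

section Necessity

open Matrix WithLp

theorem star_dotProduct_self_eq_norm_sq {ι : Type*} [Fintype ι] (x : ι → ℂ) :
    star x ⬝ᵥ x = ((‖toLp 2 x‖ ^ 2 : ℝ) : ℂ) := by
  have h := inner_self_eq_norm_sq_to_K (𝕜 := ℂ) (toLp 2 x : EuclideanSpace ℂ ι)
  rw [EuclideanSpace.inner_eq_star_dotProduct, dotProduct_comm] at h
  rw [h]
  push_cast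
  rfl

theorem star_dotProduct_conjTranspose_mul_self_mulVec {ι κ : Type*} [Fintype ι] [Fintype κ]
    (V : Matrix κ ι ℂ) (c : ι → ℂ) :
    star c ⬝ᵥ ((Vᴴ * V) *ᵥ c) = ((‖toLp 2 (V *ᵥ c)‖ ^ 2 : ℝ) : ℂ) := by
  rw [← star_dotProduct_self_eq_norm_sq, ← mulVec_mulVec, dotProduct_mulVec, star_mulVec]

/-- A Gram matrix multiplied entrywise by `1 - conj (a i) * a j` is positive semidefinite if and
only if the diagonal operator `a` is contractive with respect to the Gram matrix. -/
theorem posSemidef_one_sub_mul_gram_iff {ι : Type*} [Fintype ι] [DecidableEq ι]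
    (W : Matrix ι ι ℂ) (a : ι → ℂ) :
    (of fun i j => (1 - (starRingEnd ℂ) (a i) * a j) * (Wᴴ * W) i j).PosSemidef ↔
      ∀ c : ι → ℂ, ‖toLp 2 (W *ᵥ (a * c))‖ ≤ ‖toLp 2 (W *ᵥ c)‖ := by
  have hM : (of fun i j => (1 - (starRingEnd ℂ) (a i) * a j) * (Wᴴ * W) i j) =
      Wᴴ * W - (W * diagonal a)ᴴ * (W * diagonal a) := by
    ext i j
    rw [conjTranspose_mul, Matrix.mul_assoc, ← Matrix.mul_assoc Wᴴ, ← Matrix.mul_assoc,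
      diagonal_conjTranspose, Matrix.sub_apply, Matrix.mul_diagonal, Matrix.diagonal_mul, of_apply,
      Pi.star_apply, starRingEnd_apply]
    ring
  have hq : ∀ c : ι → ℂ, star c ⬝ᵥ ((Wᴴ * W - (W * diagonal a)ᴴ * (W * diagonal a)) *ᵥ c) =
      ((‖toLp 2 (W *ᵥ c)‖ ^ 2 - ‖toLp 2 (W *ᵥ (a * c))‖ ^ 2 : ℝ) : ℂ) := by
    intro c
    have hd : (W * diagonal a) *ᵥ c = W *ᵥ (a * c) := by
      rw [← mulVec_mulVec]
      congr 1
      ext i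
      rw [mulVec_diagonal, Pi.mul_apply]
    rw [sub_mulVec, dotProduct_sub, star_dotProduct_conjTranspose_mul_self_mulVec,
      star_dotProduct_conjTranspose_mul_self_mulVec, hd]
    push_cast
    rfl
  rw [hM, posSemidef_iff_dotProduct_mulVec]
  simp only [hq]
  constructor
  · intro h c
    have := Complex.zero_le_real.1 (h.2 c)
    exact (sq_le_sq₀ (norm_nonneg _) (norm_nonneg _)).1 (sub_nonneg.1 this)
  · intro h
    refine ⟨(isHermitian_conjTranspose_mul_self W).sub (isHermitian_conjTranspose_mul_self _),
      fun c => Complex.zero_le_real.2 (sub_nonneg.2 ?_)⟩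
    gcongr
    exact h c

/-- The operator acting as the diagonal operator `d` on the columns of the matrix `W`. -/
noncomputable def columnMultiplier {ι : Type*} [Fintype ι] [DecidableEq ι] (W : Matrix ι ι ℂ)
    (d : ι → ℂ) : EuclideanSpace ℂ ι →L[ℂ] EuclideanSpace ℂ ι :=
  toEuclideanCLM (𝕜 := ℂ) (W * diagonal d * W⁻¹)

section

variable {ι : Type*} [Fintype ι] [DecidableEq ι] {W : Matrix ι ι ℂ}

theorem columnMultiplier_apply (hW : IsUnit W.det) (d c : ι → ℂ) :
    columnMultiplier W d (toLp 2 (W *ᵥ c)) = toLp 2 (W *ᵥ (d * c)) := by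
  rw [columnMultiplier, toEuclideanCLM_toLp, mulVec_mulVec, Matrix.mul_assoc,
    nonsing_inv_mul _ hW, Matrix.mul_one, ← mulVec_mulVec]
  congr 2
  ext i
  rw [mulVec_diagonal, Pi.mul_apply]

theorem columnMultiplier_mul (hW : IsUnit W.det) (d e : ι → ℂ) :
    columnMultiplier W (d * e) = columnMultiplier W d * columnMultiplier W e := by
  rw [columnMultiplier, columnMultiplier, columnMultiplier, ← map_mul]
  congr 1
  rw [show diagonal (d * e) = diagonal d * diagonal e from (diagonal_mul_diagonal d e).symm]
  simp only [Matrix.mul_assoc]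
  rw [nonsing_inv_mul_cancel_left _ _ hW]

theorem columnMultiplier_const (hW : IsUnit W.det) (a : ℂ) :
    columnMultiplier W (fun _ => a) = algebraMap ℂ _ a := by
  rw [columnMultiplier, show diagonal (fun _ : ι => a) = a • (1 : Matrix ι ι ℂ) by
      rw [smul_one_eq_diagonal], Matrix.mul_smul, Matrix.mul_one, Matrix.smul_mul,
    mul_nonsing_inv _ hW, map_smul, map_one, Algebra.algebraMap_eq_smul_one]

theorem columnMultiplier_sub (d e : ι → ℂ) :
    columnMultiplier W (d - e) = columnMultiplier W d - columnMultiplier W e := by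
  rw [columnMultiplier, columnMultiplier, columnMultiplier, ← map_sub, ← Matrix.sub_mul,
    ← Matrix.mul_sub, diagonal_sub]
  rfl

theorem columnMultiplier_inverse (hW : IsUnit W.det) {d : ι → ℂ} (hd : ∀ i, d i ≠ 0) :
    IsUnit (columnMultiplier W d) ∧
      Ring.inverse (columnMultiplier W d) = columnMultiplier W d⁻¹ := by
  have h1 : columnMultiplier W (fun _ : ι => (1 : ℂ)) = 1 := by
    rw [columnMultiplier_const hW, map_one]
  have hmul : d * d⁻¹ = fun _ => 1 := funext fun i => mul_inv_cancel₀ (hd i)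
  have h2 : columnMultiplier W d * columnMultiplier W d⁻¹ = 1 := by
    rw [← columnMultiplier_mul hW, hmul, h1]
  have h3 : columnMultiplier W d⁻¹ * columnMultiplier W d = 1 := by
    rw [← columnMultiplier_mul hW, mul_comm, hmul, h1]
  exact ⟨⟨⟨_, _, h2, h3⟩, rfl⟩, Ring.inverse_unit ⟨_, _, h2, h3⟩⟩

theorem spectrum_columnMultiplier_subset (hW : IsUnit W.det) (d : ι → ℂ) :
    spectrum ℂ (columnMultiplier W d) ⊆ Set.range d := by
  intro z hz
  by_contra hd
  refine hz ?_
  rw [spectrum.mem_resolventSet_iff, ← columnMultiplier_const hW, ← columnMultiplier_sub]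
  exact (columnMultiplier_inverse hW fun i h0 => hd ⟨i, (sub_eq_zero.1 h0).symm⟩).1

theorem norm_columnMultiplier_le_one_iff (hW : IsUnit W.det) (d : ι → ℂ) :
    ‖columnMultiplier W d‖ ≤ 1 ↔
      ∀ c : ι → ℂ, ‖toLp 2 (W *ᵥ (d * c))‖ ≤ ‖toLp 2 (W *ᵥ c)‖ := by
  constructor
  · intro h c
    have := (columnMultiplier W d).le_of_opNorm_le h (toLp 2 (W *ᵥ c))
    rwa [columnMultiplier_apply hW, one_mul] at this
  · intro h
    refine ContinuousLinearMap.opNorm_le_bound _ zero_le_one fun y => ?_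
    have hy : y = toLp 2 (W *ᵥ (W⁻¹ *ᵥ ofLp y)) := by
      rw [mulVec_mulVec, mul_nonsing_inv _ hW, one_mulVec]
    rw [hy, columnMultiplier_apply hW, one_mul]
    exact h _

end

/-- The test operator is `columnMultiplier W lam` with `g = Wᴴ * W`. The index type lies in `Type u`
so that this operator acts on a space in the universe over which `dpNorm` takes its supremum. -/
theorem posSemidef_of_mem_dpSchur {δ : ℝ} (hδ0 : 0 < δ) (hδ1 : δ < 1) {ι : Type u} [Fintype ι]
    {lam : ι → ℂ} (hlam : ∀ j, lam j ∈ annulus δ) {φ : ℂ → ℂ} (hφ : φ ∈ dpSchur.{u} δ)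
    {g : Matrix ι ι ℂ} (hg : g.PosDef)
    (h1 : (of fun i j => (1 - (starRingEnd ℂ) (lam i) * lam j) * g i j).PosSemidef)
    (h2 : (of fun i j => (1 - (δ / (starRingEnd ℂ) (lam i)) * (δ / lam j)) * g i j).PosSemidef) :
    (of fun i j => (1 - (starRingEnd ℂ) (φ (lam i)) * φ (lam j)) * g i j).PosSemidef := by
  classical
  obtain ⟨W, rfl⟩ : ∃ W : Matrix ι ι ℂ, g = Wᴴ * W := by
    open scoped MatrixOrder in
    exact CStarAlgebra.nonneg_iff_eq_star_mul_self.mp hg.posSemidef.nonneg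
  have hW : IsUnit W.det := by
    have := (isUnit_iff_isUnit_det _).1 hg.isUnit
    rw [det_mul] at this
    exact isUnit_of_mul_isUnit_right this
  have hne : ∀ i, lam i ≠ 0 := by
    intro i h0
    have := (hlam i).1
    rw [h0, norm_zero] at this
    linarith
  have h2' := (posSemidef_one_sub_mul_gram_iff W fun i => δ / lam i).1 (by
    convert h2 using 6
    rw [map_div₀, Complex.conj_ofReal])
  have hX1 := (norm_columnMultiplier_le_one_iff hW lam).2 ((posSemidef_one_sub_mul_gram_iff W _).1 h1)
  have hX2 := (norm_columnMultiplier_le_one_iff hW _).2 h2'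
  obtain ⟨hu, hinv⟩ := columnMultiplier_inverse hW hne
  have hspec : spectrum ℂ (columnMultiplier W lam) ⊆ annulus δ := by
    refine (spectrum_columnMultiplier_subset hW lam).trans ?_
    rintro _ ⟨i, rfl⟩
    exact hlam i
  have hmem : columnMultiplier W lam ∈ dpFamily δ (EuclideanSpace ℂ ι) := by
    refine ⟨⟨hu, hX1, ?_⟩, hspec⟩
    have hsplit : (fun i => (δ : ℂ) / lam i) = (fun _ => (δ : ℂ)) * lam⁻¹ := by
      ext i
      simp [div_eq_mul_inv]
    rw [hsplit, columnMultiplier_mul hW, columnMultiplier_const hW, Algebra.algebraMap_eq_smul_one,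
      smul_mul_assoc, one_mul, norm_smul, Complex.norm_real, Real.norm_of_nonneg hδ0.le] at hX2
    rw [hinv, le_div_iff₀' hδ0]
    exact hX2
  have hle : ‖annulusCalculus δ φ (columnMultiplier W lam)‖ₑ ≤ 1 := by
    refine le_trans ?_ hφ.2
    rw [dpNorm]
    exact le_iSup_of_le (EuclideanSpace ℂ ι) (le_iSup_of_le inferInstance
      (le_iSup_of_le inferInstance (le_iSup_of_le inferInstance
        (le_iSup_of_le (columnMultiplier W lam) (le_iSup_of_le hmem le_rfl)))))
  -- The two operators agree on the columns of `W`, which span because `W` is invertible.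
  have hφX : annulusCalculus δ φ (columnMultiplier W lam) = columnMultiplier W (φ ∘ lam) := by
    have hsing : ∀ j, annulusCalculus δ φ (columnMultiplier W lam)
        (toLp 2 (W *ᵥ Pi.single j 1)) = φ (lam j) • toLp 2 (W *ᵥ Pi.single j 1) := by
      intro j
      refine annulusCalculus_apply_of_eigenvector hδ0 hδ1 hspec hφ.1 ?_
      rw [columnMultiplier_apply hW, ← toLp_smul, ← mulVec_smul]
      congr 2
      ext i
      rcases eq_or_ne i j with rfl | hij <;> simp [*]
    ext1 y
    have hy : y = ∑ j, (W⁻¹ *ᵥ ofLp y) j • toLp 2 (W *ᵥ Pi.single j 1) := by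
      simp_rw [← toLp_smul, ← mulVec_smul, ← toLp_sum, ← mulVec_sum]
      rw [show (∑ j, (W⁻¹ *ᵥ ofLp y) j • Pi.single j (1 : ℂ)) = W⁻¹ *ᵥ ofLp y from
        (pi_eq_sum_univ' _).symm, mulVec_mulVec, mul_nonsing_inv _ hW, one_mulVec]
    rw [hy]
    simp only [map_sum, map_smul, hsing]
    refine Finset.sum_congr rfl fun j _ => ?_
    rw [columnMultiplier_apply hW, ← toLp_smul 2 (φ (lam j)), ← mulVec_smul]
    congr 3
    ext i
    rcases eq_or_ne i j with rfl | hij <;> simp [*]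
  rw [hφX, ← ofReal_norm, ENNReal.ofReal_le_one] at hle
  exact (posSemidef_one_sub_mul_gram_iff W (φ ∘ lam)).2
    ((norm_columnMultiplier_le_one_iff hW _).1 hle)

/-- The necessity half of the interpolation theorem. -/
theorem posSemidef_of_exists_dpSchur {δ : ℝ} (hδ0 : 0 < δ) (hδ1 : δ < 1) {n : ℕ}
    {lam : Fin n → ℂ} (hlam : ∀ j, lam j ∈ annulus δ) {φ : ℂ → ℂ} (hφ : φ ∈ dpSchur.{u} δ)
    {g : Matrix (Fin n) (Fin n) ℂ} (hg : g ∈ dpSzegoKernels δ lam) :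
    (of fun i j => (1 - (starRingEnd ℂ) (φ (lam i)) * φ (lam j)) * g i j).PosSemidef := by
  have e : ULift.{u} (Fin n) ≃ Fin n := Equiv.ulift
  have := posSemidef_of_mem_dpSchur hδ0 hδ1 (lam := lam ∘ e) (fun j => hlam _) hφ
    (hg.1.submatrix e.injective) (hg.2.1.submatrix e) (hg.2.2.submatrix e)
  exact (posSemidef_submatrix_equiv e).1 this

end Necessity

/-! ### Duality: the Pick matrix lies in a closed convex cone -/

section Duality

open Matrix WithLp

theorem Matrix.PosSemidef.exists_gram {ι : Type*} [Fintype ι] {Γ : Matrix ι ι ℂ}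
    (h : Γ.PosSemidef) : ∃ w : ι → EuclideanSpace ℂ ι, ∀ i j, Γ i j = inner ℂ (w i) (w j) := by
  classical
  obtain ⟨W, rfl⟩ : ∃ W : Matrix ι ι ℂ, Γ = Wᴴ * W := by
    open scoped MatrixOrder in
    exact CStarAlgebra.nonneg_iff_eq_star_mul_self.mp h.nonneg
  refine ⟨fun i => toLp 2 fun k => W k i, fun i j => ?_⟩
  rw [EuclideanSpace.inner_eq_star_dotProduct, dotProduct_comm]
  rfl

/-- Cauchy-Schwarz for Gram vectors; it reduces compactness to control of the diagonal. -/
theorem Matrix.PosSemidef.norm_apply_le {ι : Type*} [Fintype ι] {Γ : Matrix ι ι ℂ}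
    (h : Γ.PosSemidef) {B : ℝ} (hB : ∀ i, (Γ i i).re ≤ B) (i j : ι) : ‖Γ i j‖ ≤ B := by
  obtain ⟨w, hw⟩ := h.exists_gram
  have hn : ∀ i, ‖w i‖ ^ 2 ≤ B := by
    intro i
    have := hB i
    rw [hw] at this
    rwa [norm_sq_eq_re_inner (𝕜 := ℂ)]
  rw [hw]
  refine (norm_inner_le_norm (𝕜 := ℂ) _ _).trans ?_
  nlinarith [hn i, hn j, sq_nonneg (‖w i‖ - ‖w j‖)]

theorem isClosed_setOf_posSemidef (ι : Type*) [Fintype ι] :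
    IsClosed {Γ : ι → ι → ℂ | (of Γ).PosSemidef} := by
  simp only [posSemidef_iff_dotProduct_mulVec, Set.ofPred_and, Set.ofPred_forall]
  refine IsClosed.inter ?_ (isClosed_iInter fun x => ?_)
  · refine isClosed_eq (f := fun (Γ : ι → ι → ℂ) i j => (starRingEnd ℂ) (Γ j i)) (g := id) ?_
      continuous_id
    exact continuous_pi fun i => continuous_pi fun j =>
      Complex.continuous_conj.comp (continuous_apply_apply j i)
  · refine isClosed_Ici.preimage (f := fun Γ : ι → ι → ℂ => star x ⬝ᵥ (of Γ *ᵥ x)) ?_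
    simp only [dotProduct, mulVec, of_apply]
    fun_prop

/-- The cone of sums of two positive semidefinite matrices with fixed entrywise weights. -/
def weightedPosSemidefCone {ι : Type*} (p q : ι → ι → ℂ) : Set (ι → ι → ℂ) :=
  {M | ∃ Γ Δ : ι → ι → ℂ, (of Γ).PosSemidef ∧ (of Δ).PosSemidef ∧ M = p * Γ + q * Δ}

theorem convex_weightedPosSemidefCone {ι : Type*} (p q : ι → ι → ℂ) :
    Convex ℝ (weightedPosSemidefCone p q) := by
  rintro _ ⟨Γ, Δ, hΓ, hΔ, rfl⟩ _ ⟨Γ', Δ', hΓ', hΔ', rfl⟩ a b ha hb -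
  refine ⟨a • Γ + b • Γ', a • Δ + b • Δ', ?_, ?_, ?_⟩
  · exact (PosSemidef.smul hΓ ha).add (PosSemidef.smul hΓ' hb)
  · exact (PosSemidef.smul hΔ ha).add (PosSemidef.smul hΔ' hb)
  · simp only [mul_add, mul_smul_comm, smul_add]
    abel

theorem smul_mem_weightedPosSemidefCone {ι : Type*} {p q M : ι → ι → ℂ}
    (hM : M ∈ weightedPosSemidefCone p q) {t : ℝ} (ht : 0 ≤ t) :
    t • M ∈ weightedPosSemidefCone p q := by
  obtain ⟨Γ, Δ, hΓ, hΔ, rfl⟩ := hM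
  exact ⟨t • Γ, t • Δ, PosSemidef.smul hΓ ht, PosSemidef.smul hΔ ht, by
    simp only [mul_smul_comm, smul_add]⟩

/-- Since the weights are positive on the diagonal, a bound on the sum bounds the nonnegative
diagonals of both summands, hence all their entries. A convergent subsequence of the pairs `(Γ, Δ)`
then represents the limit. -/
theorem isClosed_weightedPosSemidefCone {ι : Type*} [Fintype ι] {p q : ι → ι → ℂ}
    (hp : ∀ i, 0 < p i i) (hq : ∀ i, 0 < q i i) : IsClosed (weightedPosSemidefCone p q) := by
  refine IsSeqClosed.isClosed fun M M₀ hM hlim => ?_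
  choose Γ Δ hΓ hΔ hMeq using hM
  obtain ⟨B, hB⟩ := (Metric.isBounded_range_of_tendsto M hlim).exists_norm_le
  have hB' : ∀ k i, (M k i i).re ≤ B := fun k i =>
    (Complex.re_le_norm _).trans (((norm_le_pi_norm (M k i) i).trans (norm_le_pi_norm (M k) i)).trans
      (hB _ ⟨k, rfl⟩))
  have hdiag : ∀ k i, (p i i).re * (Γ k i i).re + (q i i).re * (Δ k i i).re ≤ B ∧
      0 ≤ (Γ k i i).re ∧ 0 ≤ (Δ k i i).re := by
    intro k i
    have h1 := Complex.le_def.1 ((hΓ k).diag_nonneg (i := i))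
    have h2 := Complex.le_def.1 ((hΔ k).diag_nonneg (i := i))
    have h3 := hB' k i
    have h4 := (Complex.lt_def.1 (hp i)).2
    have h5 := (Complex.lt_def.1 (hq i)).2
    rw [hMeq] at h3
    simp only [Pi.add_apply, Pi.mul_apply, Complex.add_re, Complex.mul_re] at h3
    simp only [of_apply, Complex.zero_re, Complex.zero_im] at h1 h2 h4 h5
    rw [← h4, ← h5] at h3
    exact ⟨by linarith, h1.1, h2.1⟩
  have hp' : ∀ i, 0 < (p i i).re := fun i => (Complex.lt_def.1 (hp i)).1
  have hq' : ∀ i, 0 < (q i i).re := fun i => (Complex.lt_def.1 (hq i)).1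
  have hbdd : ∀ {w : ι → ℝ}, (∀ i, 0 < w i) →
      ∃ B' : ℝ, 0 ≤ B' ∧ ∀ i x, 0 ≤ x → w i * x ≤ B → x ≤ B' := by
    intro w hw
    refine ⟨∑ i, |B / w i|, Finset.sum_nonneg fun _ _ => abs_nonneg _, fun i x _ h => ?_⟩
    calc x ≤ B / w i := by rwa [le_div_iff₀' (hw i)]
      _ ≤ |B / w i| := le_abs_self _
      _ ≤ _ := Finset.single_le_sum (f := fun i => |B / w i|) (fun _ _ => abs_nonneg _)
        (Finset.mem_univ i)
  obtain ⟨B₁, hB₁0, hB₁⟩ := hbdd hp'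
  obtain ⟨B₂, hB₂0, hB₂⟩ := hbdd hq'
  have hΓB : ∀ k, Γ k ∈ Metric.closedBall (0 : ι → ι → ℂ) B₁ := by
    intro k
    rw [mem_closedBall_zero_iff, pi_norm_le_iff_of_nonneg hB₁0]
    intro i
    rw [pi_norm_le_iff_of_nonneg hB₁0]
    intro j
    refine (hΓ k).norm_apply_le (fun i => hB₁ i _ (hdiag k i).2.1 ?_) i j
    have := mul_nonneg (hq' i).le (hdiag k i).2.2
    simp only [of_apply]
    linarith [(hdiag k i).1]
  have hΔB : ∀ k, Δ k ∈ Metric.closedBall (0 : ι → ι → ℂ) B₂ := by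
    intro k
    rw [mem_closedBall_zero_iff, pi_norm_le_iff_of_nonneg hB₂0]
    intro i
    rw [pi_norm_le_iff_of_nonneg hB₂0]
    intro j
    refine (hΔ k).norm_apply_le (fun i => hB₂ i _ (hdiag k i).2.2 ?_) i j
    have := mul_nonneg (hp' i).le (hdiag k i).2.1
    simp only [of_apply]
    linarith [(hdiag k i).1]
  obtain ⟨⟨Γ₀, Δ₀⟩, -, s, hs, hlim'⟩ :=
    ((isCompact_closedBall (0 : ι → ι → ℂ) B₁).prod
      (isCompact_closedBall (0 : ι → ι → ℂ) B₂)).tendsto_subseq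
      (x := fun k => (Γ k, Δ k)) fun k => ⟨hΓB k, hΔB k⟩
  have hΓlim := (continuous_fst.tendsto _).comp hlim'
  have hΔlim := (continuous_snd.tendsto _).comp hlim'
  refine ⟨Γ₀, Δ₀, (isClosed_setOf_posSemidef ι).mem_of_tendsto hΓlim (.of_forall fun k => hΓ _),
    (isClosed_setOf_posSemidef ι).mem_of_tendsto hΔlim (.of_forall fun k => hΔ _), ?_⟩
  refine tendsto_nhds_unique (hlim.comp hs.tendsto_atTop) ?_
  have := (hΓlim.const_mul p).add (hΔlim.const_mul q)
  refine this.congr fun k => ?_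
  simp [hMeq]

/-- On Hermitian matrices only the Hermitian part of the coefficient matrix contributes to the real
part of a functional; the sign makes a functional that is nonpositive on the cone into a positive
kernel. -/
theorem re_linearFunctional_eq_neg_sum {ι : Type*} [Fintype ι] (a M : ι → ι → ℂ)
    (hM : (of M).IsHermitian) :
    ∑ i, ∑ j, -((a i j + (starRingEnd ℂ) (a j i)) / 2) * M i j =
      ((-(∑ i, ∑ j, a i j * M i j).re : ℝ) : ℂ) := by
  have h1 : (starRingEnd ℂ) (∑ i, ∑ j, a i j * M i j) =
      ∑ i, ∑ j, (starRingEnd ℂ) (a j i) * M i j := by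
    simp only [map_sum, map_mul]
    rw [Finset.sum_comm]
    refine Finset.sum_congr rfl fun i _ => Finset.sum_congr rfl fun j _ => ?_
    congr 1
    exact hM.apply i j
  rw [Complex.ofReal_neg, Complex.re_eq_add_conj, h1, ← Finset.sum_add_distrib, Finset.sum_div,
    ← Finset.sum_neg_distrib]
  refine Finset.sum_congr rfl fun i _ => ?_
  rw [← Finset.sum_add_distrib, Finset.sum_div, ← Finset.sum_neg_distrib]
  refine Finset.sum_congr rfl fun j _ => ?_
  ring

/-- A Hermitian matrix which pairs to a positive semidefinite matrix with all positive definite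
matrices in the dual of the cone `weightedPosSemidefCone p q` lies in the cone. -/
theorem mem_weightedPosSemidefCone {ι : Type*} [Fintype ι] {p q T : ι → ι → ℂ}
    (hp : ∀ i, 0 < p i i) (hq : ∀ i, 0 < q i i) (hpH : (of p).IsHermitian)
    (hqH : (of q).IsHermitian) (hT : (of T).IsHermitian)
    (hpos : ∀ g : ι → ι → ℂ, (of (p * g)).PosSemidef → (of g).PosSemidef)
    {g₀ : ι → ι → ℂ} (hg₀ : (of g₀).PosDef) (hpg₀ : (of (p * g₀)).PosSemidef)
    (hqg₀ : (of (q * g₀)).PosSemidef)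
    (h : ∀ g : ι → ι → ℂ, (of g).PosDef → (of (p * g)).PosSemidef → (of (q * g)).PosSemidef →
      (of (T * g)).PosSemidef) : T ∈ weightedPosSemidefCone p q := by
  classical
  by_contra hTC
  obtain ⟨f, u, hfu, huT⟩ := RCLike.geometric_hahn_banach_closed_point (𝕜 := ℂ)
    (convex_weightedPosSemidefCone p q) (isClosed_weightedPosSemidefCone hp hq) hTC
  have hu : 0 < u := by
    have := hfu 0 ⟨0, 0, PosSemidef.zero, PosSemidef.zero, by simp⟩
    simpa using this
  have hfC : ∀ M ∈ weightedPosSemidefCone p q, (f M).re ≤ 0 := by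
    intro M hM
    by_contra! hlt
    -- This multiple of `M` would have `Re f` equal to `u`, not below it.
    have := hfu _ (smul_mem_weightedPosSemidefCone hM (t := u / (f M).re) (by positivity))
    rw [← algebraMap_smul ℂ (u / (f M).re) M, map_smul] at this
    simp [hlt.ne'] at this
  set a : ι → ι → ℂ := fun i j => f (Pi.single i (Pi.single j 1)) with ha
  have hfa : ∀ M, f M = ∑ i, ∑ j, a i j * M i j := by
    intro M
    have hM : M = ∑ i, ∑ j, M i j • Pi.single i (Pi.single j (1 : ℂ)) := by
      ext k l
      simp [Finset.sum_apply, Pi.single_apply, ite_apply]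
    conv_lhs => rw [hM]
    simp only [map_sum, map_smul, smul_eq_mul, ha, mul_comm]
  set g : ι → ι → ℂ := fun i j => -((a i j + (starRingEnd ℂ) (a j i)) / 2) with hg
  have hgH : (of g).IsHermitian := by
    ext i j
    simp [hg, add_comm]
  have hgM : ∀ M : ι → ι → ℂ, (of M).IsHermitian →
      ∑ i, ∑ j, g i j * M i j = ((-(f M).re : ℝ) : ℂ) := fun M hM => by
    rw [hfa]
    exact re_linearFunctional_eq_neg_sum a M hM
  have hmulH : ∀ {r s : ι → ι → ℂ}, (of r).IsHermitian → (of s).IsHermitian →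
      (of (r * s)).IsHermitian := fun hr hs => hr.hadamard hs
  -- The quadratic form of `r * g` at `c` is the pairing of `g` with `r * K c`, so the rank-one
  -- elements of the cone already give positivity of `p * g` and `q * g`.
  set K : (ι → ℂ) → ι → ι → ℂ := fun c i j => star (c i) * c j with hK
  have hquad : ∀ (r : ι → ι → ℂ) (c : ι → ℂ), star c ⬝ᵥ (of (r * g) *ᵥ c) =
      ∑ i, ∑ j, g i j * (r * K c) i j := by
    intro r c
    simp only [dotProduct, mulVec, of_apply, Finset.mul_sum, Pi.mul_apply, Pi.star_apply, hK]
    refine Finset.sum_congr rfl fun i _ => Finset.sum_congr rfl fun j _ => ?_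
    ring
  have hrank : ∀ c : ι → ℂ, (of (K c)).PosSemidef := posSemidef_vecMulVec_star_self
  have hdual : ∀ r : ι → ι → ℂ, (of r).IsHermitian →
      (∀ c : ι → ℂ, (r * K c) ∈ weightedPosSemidefCone p q) →
      (of (r * g)).PosSemidef := by
    intro r hr hrC
    refine PosSemidef.of_dotProduct_mulVec_nonneg (hmulH hr hgH) fun c => ?_
    rw [hquad, hgM _ (hmulH hr (hrank c).isHermitian)]
    exact Complex.zero_le_real.2 (neg_nonneg.2 (hfC _ (hrC c)))
  have hpg := hdual p hpH fun c => ⟨_, 0, hrank c, PosSemidef.zero, by simp⟩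
  have hqg := hdual q hqH fun c => ⟨0, _, PosSemidef.zero, hrank c, by simp⟩
  have hgpos := hpos g hpg
  set s : ℂ := ∑ i, ∑ j, g₀ i j * T i j with hs
  -- `g` is only semidefinite, so `h` is applied to the definite matrix `g + ε • g₀`. Testing on the
  -- all-ones vector sums the entries and recovers the pairing with `T`.
  have hε : ∀ ε : ℝ, 0 < ε → (f T).re ≤ ε * s.re := by
    intro ε hε
    have hadd : ∀ r : ι → ι → ℂ, r * (g + ε • g₀) = r * g + ε • (r * g₀) := fun r => by
      rw [mul_add, mul_smul_comm]
    have h1 := h (g + ε • g₀) (PosDef.posSemidef_add hgpos (PosDef.smul hg₀ hε))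
      (by rw [hadd]; exact hpg.add (PosSemidef.smul hpg₀ hε.le))
      (by rw [hadd]; exact hqg.add (PosSemidef.smul hqg₀ hε.le))
    have h2 := h1.dotProduct_mulVec_nonneg 1
    have h3 : star (1 : ι → ℂ) ⬝ᵥ (of (T * (g + ε • g₀)) *ᵥ 1) =
        ∑ i, ∑ j, g i j * T i j + ε * s := by
      simp only [dotProduct, mulVec, of_apply, hs, Finset.mul_sum, ← Finset.sum_add_distrib]
      refine Finset.sum_congr rfl fun i _ => Finset.sum_congr rfl fun j _ => ?_
      simp
      ring
    rw [h3, hgM T hT] at h2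
    have h4 := (Complex.le_def.1 h2).1
    simp at h4
    linarith
  have huT' : u < (f T).re := huT
  -- With this `ε` the bound `ε * s.re` is at most `u`, contradicting `u < (f T).re`.
  have h1 := hε (u / (|s.re| + 1)) (by positivity)
  have h2 : u / (|s.re| + 1) * s.re ≤ u := by
    rw [div_mul_eq_mul_div, div_le_iff₀ (by positivity)]
    nlinarith [le_abs_self s.re]
  linarith

/-- The Szegő kernel of the disc is positive definite on finite sets. -/
theorem posDef_szego {n : ℕ} {a : Fin n → ℂ} (ha : ∀ i, ‖a i‖ < 1) (hinj : Function.Injective a) :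
    (of fun i j => (1 - (starRingEnd ℂ) (a i) * a j)⁻¹).PosDef := by
  -- The geometric series writes the quadratic form as a sum of squares.
  have hsum : ∀ c : Fin n → ℂ, HasSum (fun k : ℕ => ((‖∑ j, c j * a j ^ k‖ ^ 2 : ℝ) : ℂ))
      (star c ⬝ᵥ ((of fun i j => (1 - (starRingEnd ℂ) (a i) * a j)⁻¹) *ᵥ c)) := by
    intro c
    simp only [dotProduct, mulVec, of_apply, Finset.mul_sum]
    have h1 : ∀ i j, HasSum (fun k : ℕ => star c i * (((starRingEnd ℂ) (a i) * a j) ^ k * c j))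
        (star c i * ((1 - (starRingEnd ℂ) (a i) * a j)⁻¹ * c j)) := by
      intro i j
      have hlt : ‖(starRingEnd ℂ) (a i) * a j‖ < 1 := by
        rw [norm_mul, RCLike.norm_conj]
        exact mul_lt_one_of_nonneg_of_lt_one_left (norm_nonneg _) (ha i) (ha j).le
      exact ((hasSum_geometric_of_norm_lt_one hlt).mul_right (c j)).mul_left (star c i)
    have h2 := hasSum_sum fun i (_ : i ∈ Finset.univ) =>
      hasSum_sum fun j (_ : j ∈ Finset.univ) => h1 i j
    convert h2 using 2 with k
    have h3 : ((‖∑ j, c j * a j ^ k‖ ^ 2 : ℝ) : ℂ) =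
        (starRingEnd ℂ) (∑ j, c j * a j ^ k) * ∑ j, c j * a j ^ k := by
      rw [Complex.conj_mul']
      push_cast
      rfl
    rw [h3, map_sum, Finset.sum_mul_sum]
    refine Finset.sum_congr rfl fun i _ => Finset.sum_congr rfl fun j _ => ?_
    rw [map_mul, map_pow, mul_pow, Pi.star_apply, starRingEnd_apply, starRingEnd_apply]
    ring
  refine PosDef.of_dotProduct_mulVec_pos ?_ fun c hc => ?_
  · ext i j
    simp [mul_comm]
  have hre := Complex.hasSum_re (hsum c)
  have him := Complex.hasSum_im (hsum c)
  simp only [Complex.ofReal_re, Complex.ofReal_im] at hre him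
  refine Complex.lt_def.2 ⟨?_, him.unique hasSum_zero |>.symm⟩
  -- Vandermonde: for distinct nodes, the first `n` power sums cannot all vanish unless `c = 0`.
  obtain ⟨k, hk⟩ : ∃ k : Fin n, ∑ j, c j * a j ^ (k : ℕ) ≠ 0 := by
    by_contra! h0
    exact hc (eq_zero_of_forall_pow_sum_mul_pow_eq_zero hinj h0)
  rw [← hre.tsum_eq]
  exact hre.summable.tsum_pos (fun _ => by positivity) k (by positivity)

end Duality

/-! ### Realization: lurking isometry and transfer functions -/

section Realization

open Matrix WithLp

/-- Two finite families with the same Gram matrix in a finite-dimensional space are related by a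
linear isometry of the space. -/
theorem exists_linearIsometry_of_inner_eq {ι V : Type*} [Fintype ι] [NormedAddCommGroup V]
    [InnerProductSpace ℂ V] [FiniteDimensional ℂ V] {p q : ι → V}
    (h : ∀ i j, inner ℂ (p i) (p j) = inner ℂ (q i) (q j)) :
    ∃ U : V →ₗᵢ[ℂ] V, ∀ j, U (p j) = q j := by
  classical
  set P := Fintype.linearCombination ℂ p with hP
  set Q := Fintype.linearCombination ℂ q with hQ
  have hnorm : ∀ c, ‖P c‖ = ‖Q c‖ := by
    intro c
    rw [norm_eq_sqrt_re_inner (𝕜 := ℂ), norm_eq_sqrt_re_inner (𝕜 := ℂ)]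
    simp only [hP, hQ, Fintype.linearCombination_apply, sum_inner, inner_sum, inner_smul_left,
      inner_smul_right, h]
  -- `Q ∘ s` sends `P c` to `Q c` whichever preimage `s` picks, since `‖P c‖ = ‖Q c‖` gives `ker P =
  -- ker Q`.
  obtain ⟨s, hs⟩ := P.rangeRestrict.exists_rightInverse_of_surjective P.range_rangeRestrict
  have hPs : ∀ x : LinearMap.range P, P (s x) = x := fun x =>
    congrArg Subtype.val (LinearMap.congr_fun hs x)
  let L : LinearMap.range P →ₗᵢ[ℂ] V :=
    { toLinearMap := Q ∘ₗ s
      norm_map' := fun x => by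
        rw [LinearMap.comp_apply, ← hnorm, hPs]
        rfl }
  refine ⟨L.extend, fun j => ?_⟩
  have hpj : P (Pi.single j 1) = p j := by
    rw [hP, Fintype.linearCombination_apply_single, one_smul]
  have hqj : Q (Pi.single j 1) = q j := by
    rw [hQ, Fintype.linearCombination_apply_single, one_smul]
  have hmem : p j ∈ LinearMap.range P := ⟨_, hpj⟩
  have h1 := L.extend_apply ⟨p j, hmem⟩
  rw [show L.extend (p j) = L ⟨p j, hmem⟩ from h1]
  change Q (s ⟨p j, hmem⟩) = q j
  rw [← hqj, ← sub_eq_zero, ← map_sub, ← norm_eq_zero, ← hnorm, map_sub, hPs, hpj, sub_self,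
    norm_zero]

/-- A matrix with orthonormal columns acts isometrically on tuples of vectors. -/
theorem sum_norm_sq_sum_smul {κ H : Type*} [Fintype κ] [DecidableEq κ] [NormedAddCommGroup H]
    [InnerProductSpace ℂ H] {v : κ → κ → ℂ}
    (hv : ∀ j k, ∑ i, (starRingEnd ℂ) (v i j) * v i k = if j = k then 1 else 0) (h : κ → H) :
    ∑ i, ‖∑ j, v i j • h j‖ ^ 2 = ∑ j, ‖h j‖ ^ 2 := by
  have hc : ((∑ i, ‖∑ j, v i j • h j‖ ^ 2 : ℝ) : ℂ) = ((∑ j, ‖h j‖ ^ 2 : ℝ) : ℂ) := by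
    push_cast
    have h1 : ∀ x : H, (‖x‖ : ℂ) ^ 2 = inner ℂ x x := fun x =>
      (inner_self_eq_norm_sq_to_K (𝕜 := ℂ) x).symm
    simp only [h1, sum_inner, inner_sum, inner_smul_left, inner_smul_right, Finset.mul_sum]
    rw [Finset.sum_comm]
    refine Finset.sum_congr rfl fun j _ => ?_
    rw [Finset.sum_comm]
    have h2 : ∀ k, ∑ i, v i j * ((starRingEnd ℂ) (v i k) * inner ℂ (h k) (h j)) =
        (if k = j then 1 else 0) * inner ℂ (h k) (h j) := by
      intro k
      rw [← hv, Finset.sum_mul]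
      exact Finset.sum_congr rfl fun i _ => by ring
    simp only [h2, ite_mul, one_mul, zero_mul, Finset.sum_ite_eq', Finset.mem_univ, if_true]
  exact_mod_cast hc

/-- The isometry given by `exists_linearIsometry_of_inner_eq`, as a matrix. -/
theorem exists_isometric_matrix_of_inner_eq {ι κ : Type*} [Fintype ι] [Fintype κ] [DecidableEq κ]
    {p q : ι → EuclideanSpace ℂ κ} (h : ∀ i j, inner ℂ (p i) (p j) = inner ℂ (q i) (q j)) :
    ∃ v : κ → κ → ℂ,
      (∀ j k, ∑ i, (starRingEnd ℂ) (v i j) * v i k = if j = k then 1 else 0) ∧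
      ∀ j i, ∑ k, v i k * p j k = q j i := by
  obtain ⟨U, hU⟩ := exists_linearIsometry_of_inner_eq h
  refine ⟨fun i k => U (EuclideanSpace.single k 1) i, fun j k => ?_, fun j i => ?_⟩
  · have := U.inner_map_map (EuclideanSpace.single j 1) (EuclideanSpace.single k 1)
    rw [EuclideanSpace.inner_single_left, PiLp.inner_apply] at this
    simp only [RCLike.inner_apply, map_one, one_mul, PiLp.single_apply] at this
    rw [← this]
    exact Finset.sum_congr rfl fun i _ => mul_comm _ _
  · have hp : p j = ∑ k, p j k • EuclideanSpace.single k (1 : ℂ) := by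
      ext l
      simp [Pi.single_apply]
    rw [← hU]
    conv_rhs => rw [hp]
    simp [mul_comm]

theorem differentiableOn_det {κ : Type*} [Fintype κ] [DecidableEq κ] {M : ℂ → Matrix κ κ ℂ}
    {s : Set ℂ} (hM : ∀ i j, DifferentiableOn ℂ (fun z => M z i j) s) :
    DifferentiableOn ℂ (fun z => (M z).det) s := by
  simp only [det_apply]
  exact DifferentiableOn.fun_sum fun σ _ =>
    (DifferentiableOn.fun_finsetProd fun i _ => hM _ _).const_smul _

/-- Solution of the state equation of an isometric colligation with holomorphic diagonal
feedback. -/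
theorem exists_differentiableOn_state {κ : Type*} [Fintype κ] [DecidableEq κ]
    {v : Option κ → Option κ → ℂ}
    (hv : ∀ j k, ∑ i, (starRingEnd ℂ) (v i j) * v i k = if j = k then 1 else 0)
    {E : κ → ℂ → ℂ} {s : Set ℂ} (hE : ∀ k, DifferentiableOn ℂ (E k) s)
    (hE1 : ∀ k, ∀ z ∈ s, ‖E k z‖ < 1) :
    ∃ f : κ → ℂ → ℂ, (∀ k, DifferentiableOn ℂ (f k) s) ∧ ∀ z ∈ s, ∀ w : κ → ℂ,
      (∀ k, w k = v (some k) none + ∑ l, v (some k) (some l) * (E l z * w l)) ↔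
        w = fun k => f k z := by
  set A : ℂ → Matrix κ κ ℂ := fun z => 1 - of fun k l => v (some k) (some l) * E l z with hA
  set C : κ → ℂ := fun k => v (some k) none with hC
  have hmul : ∀ z w k, (A z *ᵥ w) k = w k - ∑ l, v (some k) (some l) * (E l z * w l) := by
    intro z w k
    rw [hA, sub_mulVec, one_mulVec, Pi.sub_apply]
    simp only [mulVec, dotProduct, of_apply, mul_assoc]
  -- For `x` in the kernel, `v` maps `(0, E x)` to a vector with state part `x`, so `‖x‖ ≤ ‖E x‖`;
  -- as every `|E k z| < 1`, this forces `x = 0`.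
  have hdet : ∀ z ∈ s, (A z).det ≠ 0 := by
    intro z hz h0
    obtain ⟨x, hx0, hx⟩ := exists_mulVec_eq_zero_iff.2 h0
    have hx' : ∀ k, ∑ l, v (some k) (some l) * (E l z * x l) = x k := by
      intro k
      have := congrFun hx k
      rw [hmul, Pi.zero_apply, sub_eq_zero] at this
      exact this.symm
    have h1 := sum_norm_sq_sum_smul hv (fun i : Option κ => i.elim (0 : ℂ) fun l => E l z * x l)
    simp only [Fintype.sum_option, Option.elim, smul_eq_mul, mul_zero, zero_add, hx', norm_zero,
      ne_eq, OfNat.ofNat_ne_zero, not_false_eq_true, zero_pow] at h1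
    obtain ⟨k, hk⟩ := Function.ne_iff.1 hx0
    have hlt : ∑ l, ‖E l z * x l‖ ^ 2 < ∑ l, ‖x l‖ ^ 2 := by
      have hle : ∀ l, ‖E l z * x l‖ ≤ ‖x l‖ := fun l => by
        rw [norm_mul]
        exact mul_le_of_le_one_left (norm_nonneg _) (hE1 l z hz).le
      refine Finset.sum_lt_sum (fun l _ => by gcongr; exact hle l) ⟨k, Finset.mem_univ k, ?_⟩
      have hk' : 0 < ‖x k‖ := norm_pos_iff.2 hk
      have : ‖E k z * x k‖ < ‖x k‖ := by
        rw [norm_mul]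
        exact mul_lt_of_lt_one_left hk' (hE1 k z hz)
      gcongr
    nlinarith [sq_nonneg ‖∑ l, v none (some l) * (E l z * x l)‖]
  have hAd : ∀ i j, DifferentiableOn ℂ (fun z => A z i j) s := fun i j =>
    (differentiableOn_const _).sub ((differentiableOn_const _).mul (hE j))
  -- Cramer's rule exhibits the solution as a quotient of determinants with holomorphic entries.
  refine ⟨fun k z => (A z).det⁻¹ * cramer (A z) C k, fun k => ?_, fun z hz w => ?_⟩
  · refine ((differentiableOn_det hAd).inv hdet).mul ?_
    simp only [cramer_apply]
    refine differentiableOn_det fun i j => ?_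
    rcases eq_or_ne j k with rfl | hj
    · simp only [updateCol_self]
      exact differentiableOn_const _
    · simp only [updateCol_ne hj]
      exact hAd i j
  · have hu : IsUnit (A z).det := (hdet z hz).isUnit
    have hsol : (fun k => (A z).det⁻¹ * cramer (A z) C k) = (A z)⁻¹ *ᵥ C := by
      rw [← det_smul_inv_mulVec_eq_cramer _ _ hu]
      ext k
      rw [Pi.smul_apply, smul_eq_mul, inv_mul_cancel_left₀ (hdet z hz)]
    have hiff : (∀ k, w k = v (some k) none + ∑ l, v (some k) (some l) * (E l z * w l)) ↔
        A z *ᵥ w = C := by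
      rw [funext_iff]
      refine forall_congr' fun k => ?_
      rw [hmul, sub_eq_iff_eq_add]
    rw [hiff, hsol]
    constructor
    · rintro h
      rw [← h, mulVec_mulVec, nonsing_inv_mul _ hu, one_mulVec]
    · rintro rfl
      rw [mulVec_mulVec, mul_nonsing_inv _ hu, one_mulVec]

/-- The pair of coordinates `z` and `δ / z` on the annulus, with multiplicities. -/
noncomputable def annulusCoordinate (δ : ℝ) {α β : Type*} : α ⊕ β → ℂ → ℂ :=
  Sum.elim (fun _ z => z) fun _ z => δ * z⁻¹

theorem ne_zero_of_mem_annulus {δ : ℝ} (hδ0 : 0 < δ) {z : ℂ} (hz : z ∈ annulus δ) : z ≠ 0 :=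
  norm_pos_iff.1 (hδ0.trans hz.1)

theorem differentiableOn_annulusCoordinate {δ : ℝ} (hδ0 : 0 < δ) {α β : Type*} (k : α ⊕ β) :
    DifferentiableOn ℂ (annulusCoordinate δ k) (annulus δ) := by
  rcases k with k | k
  · exact differentiableOn_id
  · exact (differentiableOn_id.inv fun z hz => ne_zero_of_mem_annulus hδ0 hz).const_mul _

theorem norm_annulusCoordinate_lt {δ : ℝ} (hδ0 : 0 < δ) {α β : Type*} (k : α ⊕ β) {z : ℂ}
    (hz : z ∈ annulus δ) : ‖annulusCoordinate δ k z‖ < 1 := by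
  rcases k with k | k
  · exact hz.2
  · change ‖(δ : ℂ) * z⁻¹‖ < 1
    rw [norm_mul, norm_inv, Complex.norm_real, Real.norm_of_nonneg hδ0.le, ← div_eq_mul_inv,
      div_lt_one (hδ0.trans hz.1)]
    exact hz.1

/-- The Riesz-Dunford calculus turns multiplication by an annulus coordinate into multiplication by
a contraction. -/
theorem exists_rieszDunford_annulusCoordinate_mul {δ : ℝ} (hδ0 : 0 < δ) {H : Type u}
    [NormedAddCommGroup H] [InnerProductSpace ℂ H] [CompleteSpace H] {X : H →L[ℂ] H}
    (hX : IsDouglasPaulsen δ X) {r R : ℝ} (h : IsAnnularContour δ X r R) {α β : Type*}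
    (k : α ⊕ β) : ∃ Y : H →L[ℂ] H, ‖Y‖ ≤ 1 ∧ ∀ f, DifferentiableOn ℂ f (annulus δ) →
      rieszDunford (fun z => annulusCoordinate δ k z * f z) X r R = Y * rieszDunford f X r R := by
  rcases k with k | k
  · exact ⟨X, hX.norm_le, fun f hf => rieszDunford_id_mul hδ0 h hf⟩
  · refine ⟨(δ : ℂ) • Ring.inverse X, ?_, fun f hf => ?_⟩
    · rw [norm_smul, Complex.norm_real, Real.norm_of_nonneg hδ0.le, ← le_div_iff₀' hδ0]
      exact hX.norm_inverse_le
    · rw [smul_mul_assoc, ← rieszDunford_inv_mul hδ0 h hX.isUnit hf, ← rieszDunford_const_mul]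
      congr 1
      ext z
      exact mul_assoc _ _ _

/-- The transfer function of an isometric colligation over the annulus coordinates belongs to the
dp-Schur class. -/
theorem transferFunction_mem_dpSchur {δ : ℝ} (hδ0 : 0 < δ) (hδ1 : δ < 1) {α β : Type*} [Fintype α]
    [Fintype β] [DecidableEq α] [DecidableEq β] {v : Option (α ⊕ β) → Option (α ⊕ β) → ℂ}
    (hv : ∀ j k, ∑ i, (starRingEnd ℂ) (v i j) * v i k = if j = k then 1 else 0)
    {f : α ⊕ β → ℂ → ℂ} (hf : ∀ k, DifferentiableOn ℂ (f k) (annulus δ))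
    (hstate : ∀ z ∈ annulus δ, ∀ k, f k z =
      v (some k) none + ∑ l, v (some k) (some l) * (annulusCoordinate δ l z * f l z)) :
    (fun z => v none none + ∑ l, v none (some l) * (annulusCoordinate δ l z * f l z)) ∈
      dpSchur.{u} δ := by
  have hEf : ∀ l, DifferentiableOn ℂ (fun z => annulusCoordinate δ l z * f l z) (annulus δ) :=
    fun l => (differentiableOn_annulusCoordinate hδ0 l).mul (hf l)
  have hout : ∀ i, DifferentiableOn ℂ
      (fun z => v i none + ∑ l, v i (some l) * (annulusCoordinate δ l z * f l z)) (annulus δ) :=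
    fun i => (differentiableOn_const _).add
      (DifferentiableOn.fun_sum fun l _ => (hEf l).const_mul _)
  refine ⟨hout none, ?_⟩
  rw [dpNorm]
  refine iSup_le fun H => iSup_le fun _ => iSup_le fun _ => iSup_le fun _ => iSup_le fun X =>
    iSup_le fun hX => ?_
  rw [← ofReal_norm, ENNReal.ofReal_le_one]
  obtain ⟨⟨r, R⟩, h⟩ := exists_isAnnularContour hδ1 X hX.2
  dsimp only at h
  rw [annulusCalculus_eq_rieszDunford hδ0 (hout none) h]
  choose Y hY1 hY using fun k : α ⊕ β => exists_rieszDunford_annulusCoordinate_mul hδ0 hX.1 h k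
  have hcalc : ∀ i, rieszDunford
      (fun z => v i none + ∑ l, v i (some l) * (annulusCoordinate δ l z * f l z)) X r R =
      v i none • 1 + ∑ l, v i (some l) • (Y l * rieszDunford (f l) X r R) := by
    intro i
    rw [rieszDunford_add hδ0 h (differentiableOn_const _)
      (DifferentiableOn.fun_sum fun l _ => (hEf l).const_mul _),
      rieszDunford_sum hδ0 h _ fun l => (hEf l).const_mul _]
    congr 1
    · rw [← rieszDunford_one hδ0 h, ← rieszDunford_const_mul]
      simp only [mul_one]
    · refine Finset.sum_congr rfl fun l _ => ?_
      rw [rieszDunford_const_mul, hY l _ (hf l)]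
  refine ContinuousLinearMap.opNorm_le_bound _ zero_le_one fun x => ?_
  rw [one_mul]
  have happ : ∀ i, v i none • x + ∑ l, v i (some l) • Y l (rieszDunford (f l) X r R x) =
      rieszDunford (fun z => v i none + ∑ l, v i (some l) * (annulusCoordinate δ l z * f l z))
        X r R x := by
    intro i
    rw [hcalc]
    simp
  have hstate' : ∀ k, rieszDunford (fun z => v (some k) none +
      ∑ l, v (some k) (some l) * (annulusCoordinate δ l z * f l z)) X r R =
        rieszDunford (f k) X r R := fun k =>
    rieszDunford_congr hδ0 h fun z hz => (hstate z hz k).symm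
  -- Isometry of `v` on `(x, Y f(X) x)` gives `‖φ(X) x‖² + ∑ ‖f(X) x‖² = ‖x‖² + ∑ ‖Y f(X) x‖²`, and
  -- the sum on the right is at most the one on the left because each `Y l` is a contraction.
  have hsum := sum_norm_sq_sum_smul hv
    (fun i : Option (α ⊕ β) => i.elim x fun l => Y l (rieszDunford (f l) X r R x))
  simp only [Fintype.sum_option (α := α ⊕ β), Option.elim, happ, hstate'] at hsum
  have hle : ∑ l, ‖Y l (rieszDunford (f l) X r R x)‖ ^ 2 ≤
      ∑ l, ‖rieszDunford (f l) X r R x‖ ^ 2 := by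
    refine Finset.sum_le_sum fun l _ => ?_
    gcongr
    simpa using (Y l).le_of_opNorm_le (hY1 l) (rieszDunford (f l) X r R x)
  exact (sq_le_sq₀ (norm_nonneg _) (norm_nonneg _)).1 (by linarith)

/-- A decomposition of the Pick matrix produces an interpolating function. -/
theorem exists_mem_dpSchur_of_decomposition {δ : ℝ} (hδ0 : 0 < δ) (hδ1 : δ < 1) {ι : Type*}
    [Fintype ι] {lam z : ι → ℂ} (hlam : ∀ j, lam j ∈ annulus δ) {Γ Δ : Matrix ι ι ℂ}
    (hΓ : Γ.PosSemidef) (hΔ : Δ.PosSemidef)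
    (hdec : ∀ i j, 1 - (starRingEnd ℂ) (z i) * z j =
      (1 - (starRingEnd ℂ) (lam i) * lam j) * Γ i j +
        (1 - (δ / (starRingEnd ℂ) (lam i)) * (δ / lam j)) * Δ i j) :
    ∃ φ ∈ dpSchur.{u} δ, ∀ j, φ (lam j) = z j := by
  classical
  obtain ⟨a, ha⟩ := hΓ.exists_gram
  obtain ⟨b, hb⟩ := hΔ.exists_gram
  set w : ι → ι ⊕ ι → ℂ := fun j => Sum.elim (fun k => a j k) fun k => b j k with hw
  -- `p` and `q` are Gram vectors for the two sides of the decomposition rearranged without minus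
  -- signs: `1 + conj λᵢ λⱼ Γ + (δ² / (conj λᵢ λⱼ)) Δ = conj zᵢ zⱼ + Γ + Δ`.
  set p : ι → EuclideanSpace ℂ (Option (ι ⊕ ι)) := fun j =>
    toLp 2 fun i => i.elim 1 fun k => annulusCoordinate δ k (lam j) * w j k with hp
  set q : ι → EuclideanSpace ℂ (Option (ι ⊕ ι)) := fun j =>
    toLp 2 fun i => i.elim (z j) fun k => w j k with hq
  have hpq : ∀ i j, inner ℂ (p i) (p j) = inner ℂ (q i) (q j) := by
    intro i j
    have h1 := hdec i j
    rw [ha, hb] at h1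
    simp only [PiLp.inner_apply, RCLike.inner_apply] at h1
    simp only [hp, hq, hw, PiLp.inner_apply, RCLike.inner_apply, Fintype.sum_option,
      Option.elim, Fintype.sum_sum_type, Sum.elim_inl, Sum.elim_inr, annulusCoordinate, map_mul,
      map_inv₀, Complex.conj_ofReal, map_one, mul_one]
    have h2 : ∑ x, lam j * a j x * ((starRingEnd ℂ) (lam i) * (starRingEnd ℂ) (a i x)) =
        (starRingEnd ℂ) (lam i) * lam j * ∑ x, a j x * (starRingEnd ℂ) (a i x) := by
      rw [Finset.mul_sum]
      exact Finset.sum_congr rfl fun x _ => by ring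
    have h3 : ∑ x, δ * (lam j)⁻¹ * b j x *
        (δ * ((starRingEnd ℂ) (lam i))⁻¹ * (starRingEnd ℂ) (b i x)) =
        (δ / (starRingEnd ℂ) (lam i)) * (δ / lam j) * ∑ x, b j x * (starRingEnd ℂ) (b i x) := by
      rw [Finset.mul_sum]
      exact Finset.sum_congr rfl fun x _ => by ring
    rw [h2, h3]
    linear_combination h1
  obtain ⟨v, hv, hvp⟩ := exists_isometric_matrix_of_inner_eq hpq
  obtain ⟨f, hf, hfw⟩ := exists_differentiableOn_state hv
    (fun k => differentiableOn_annulusCoordinate (δ := δ) hδ0 k)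
    fun k x hx => norm_annulusCoordinate_lt hδ0 k hx
  refine ⟨_, transferFunction_mem_dpSchur hδ0 hδ1 hv hf fun x hx k =>
    ((hfw x hx _).2 rfl) k, fun j => ?_⟩
  -- The state rows of `v (p j) = q j` are the state equation at `lam j`, whose solution is unique;
  -- the remaining row is then the interpolation condition.
  have hwj : w j = fun k => f k (lam j) := by
    refine (hfw _ (hlam j) _).1 fun k => ?_
    have := hvp j (some k)
    simp only [Fintype.sum_option, hp, hq, Option.elim, mul_one] at this
    exact this.symm
  have := hvp j none
  simp only [Fintype.sum_option, hp, hq, Option.elim, mul_one, hwj] at this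
  exact this

/-- The sufficiency half of the interpolation theorem. -/
theorem exists_dpSchur_of_forall_posSemidef {δ : ℝ} (hδ0 : 0 < δ) (hδ1 : δ < 1) {n : ℕ}
    {lam : Fin n → ℂ} (hlam : ∀ j, lam j ∈ annulus δ) (hinj : Function.Injective lam)
    {z : Fin n → ℂ} (h : ∀ g ∈ dpSzegoKernels δ lam,
      (of fun i j => (1 - (starRingEnd ℂ) (z i) * z j) * g i j).PosSemidef) :
    ∃ φ ∈ dpSchur.{u} δ, ∀ j, φ (lam j) = z j := by
  have hne : ∀ i, lam i ≠ 0 := fun i => ne_zero_of_mem_annulus hδ0 (hlam i)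
  set mu : Fin n → ℂ := fun i => δ / lam i with hmu
  have hmu1 : ∀ i, ‖mu i‖ < 1 := fun i => by
    rw [hmu, norm_div, Complex.norm_real, Real.norm_of_nonneg hδ0.le,
      div_lt_one (hδ0.trans (hlam i).1)]
    exact (hlam i).1
  have hmuinj : Function.Injective mu := fun i j hij => by
    refine hinj ?_
    have hδ : (δ : ℂ) ≠ 0 := by exact_mod_cast hδ0.ne'
    simpa [hmu, div_eq_mul_inv, hδ] using hij
  set k : (Fin n → ℂ) → Fin n → Fin n → ℂ := fun a i j => 1 - (starRingEnd ℂ) (a i) * a j with hk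
  have hkH : ∀ a, (of (k a)).IsHermitian := fun a => by
    ext i j
    simp [hk, mul_comm]
  have hkdiag : ∀ a : Fin n → ℂ, (∀ i, ‖a i‖ < 1) → ∀ i, 0 < k a i i := fun a ha i => by
    have h1 : k a i i = ((1 - ‖a i‖ ^ 2 : ℝ) : ℂ) := by
      simp [hk, Complex.conj_mul']
    rw [h1]
    refine Complex.zero_lt_real.2 ?_
    nlinarith [ha i, norm_nonneg (a i)]
  have hkne : ∀ a : Fin n → ℂ, (∀ i, ‖a i‖ < 1) → ∀ i j, k a i j ≠ 0 := fun a ha i j h0 => by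
    have h1 : ‖(starRingEnd ℂ) (a i) * a j‖ < 1 := by
      rw [norm_mul, RCLike.norm_conj]
      exact mul_lt_one_of_nonneg_of_lt_one_left (norm_nonneg _) (ha i) (ha j).le
    rw [← sub_eq_zero.1 h0, norm_one] at h1
    exact lt_irrefl _ h1
  have hkmu : ∀ i j, k mu i j = 1 - (δ / (starRingEnd ℂ) (lam i)) * (δ / lam j) := fun i j => by
    simp [hk, hmu]
  have hlam1 : ∀ i, ‖lam i‖ < 1 := fun i => (hlam i).2
  have hS := posDef_szego hlam1 hinj
  have hS' := posDef_szego hmu1 hmuinj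
  obtain ⟨Γ, Δ, hΓ, hΔ, hdec⟩ := mem_weightedPosSemidefCone (T := k z) (hkdiag lam hlam1)
    (hkdiag mu hmu1) (hkH lam) (hkH mu) (hkH z)
    -- Dividing entrywise by `k lam` is Schur multiplication by the Szegő kernel, which preserves
    -- positivity.
    (fun g hg => by
      have heq : of g = of (k lam * g) ⊙ of fun i j => (k lam i j)⁻¹ := by
        ext i j
        have := hkne lam hlam1 i j
        simp only [hadamard_apply, of_apply, Pi.mul_apply]
        field_simp
      rw [heq]
      exact hg.hadamard hS.posSemidef)
    -- The product of the Szegő kernels at `lam` and at `δ / lam` is a kernel: multiplying by either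
    -- weight leaves the other Szegő kernel.
    (g₀ := fun i j => (k lam i j)⁻¹ * (k mu i j)⁻¹) (hS.hadamard hS')
    (by
      convert hS'.posSemidef using 1
      ext i j
      exact mul_inv_cancel_left₀ (hkne lam hlam1 i j) _)
    (by
      convert hS.posSemidef using 1
      ext i j
      change k mu i j * ((k lam i j)⁻¹ * (k mu i j)⁻¹) = (k lam i j)⁻¹
      have := hkne mu hmu1 i j
      field_simp)
    (fun g hg1 hg2 hg3 => h (of g) ⟨hg1, hg2, by
      convert hg3 using 1
      ext i j
      simp only [of_apply, Pi.mul_apply, hkmu]⟩)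
  refine exists_mem_dpSchur_of_decomposition hδ0 hδ1 hlam hΓ hΔ fun i j => ?_
  have := congrFun (congrFun hdec i) j
  simp only [Pi.add_apply, Pi.mul_apply, hkmu] at this
  exact this

end Realization

theorem theorem5p2 (δ : ℝ) (hδ0 : 0 < δ) (hδ1 : δ < 1) (n : ℕ)
    (lam : Fin n → ℂ) (hlam : ∀ j, lam j ∈ annulus δ) (hinj : Function.Injective lam)
    (z : Fin n → ℂ) :
    (∃ φ ∈ dpSchur.{u} δ, ∀ j, φ (lam j) = z j) ↔
      ∀ g ∈ dpSzegoKernels δ lam,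
        (Matrix.of fun i j => (1 - (starRingEnd ℂ) (z i) * z j) * g i j).PosSemidef := by
  constructor
  · rintro ⟨φ, hφ, hφz⟩ g hg
    have := posSemidef_of_exists_dpSchur hδ0 hδ1 hlam hφ hg
    simpa only [hφz] using this
  · exact exists_dpSchur_of_forall_posSemidef hδ0 hδ1 hlam hinj
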